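/- Let $\mathbb F$ be a field and let $q\in\mathbb F$ be nonzero with $q^4\neq 1$. Let $\hat H_q$ (the universal DAHA of type $(C_1^\vee,C_1)$) be the associative unital $\mathbb F$-algebra defined by generators $t_0^{\pm1},t_1^{\pm1},t_2^{\pm1},t_3^{\pm1}$ and the relations $t_it_i^{-1}=t_i^{-1}t_i=1$ and $t_i+t_i^{-1}$ is central for $0\le i\le 3$, and $t_0t_1t_2t_3=q^{-1}$. Put $T_i=t_i+t_i^{-1}$ for $0\le i\le 3$, $X=t_3t_0$ and $Y=t_0t_1$; the elements $X$ and $Y$ are invertible. Let $\mathbb N=\{0,1,2,\dots\}$. Then each of the following two families is a basis of the $\mathbb F$-vector space $\hat H_q$: (i) $Y^iX^jt_0^kT_0^{\ell}T_1^rT_2^sT_3^t$ with $i,j\in\mathbb Z$, $k\in\{0,1\}$, $\ell,r,s,t\in\mathbb N$; (ii) $Y^iX^jt_0^kT_1^rT_2^sT_3^t$ with $i,j,k\in\mathbb Z$, $r,s,t\in\mathbb N$. -/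

import Mathlib

/-- The free generators `t_i` and `t_i⁻¹` for `i ∈ {0, 1, 2, 3}`. -/
inductive UDAHAGen : Type
  | t (i : Fin 4)
  | tInv (i : Fin 4)

namespace UDAHA

section

variable {F : Type*} [Field F]

/-- The generator `t_i` of the free algebra. -/
def ft (F : Type*) [Field F] (i : Fin 4) : FreeAlgebra F UDAHAGen :=
  FreeAlgebra.ι F (UDAHAGen.t i)

/-- The generator `t_i⁻¹` of the free algebra. -/
def ftInv (F : Type*) [Field F] (i : Fin 4) : FreeAlgebra F UDAHAGen :=
  FreeAlgebra.ι F (UDAHAGen.tInv i)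

/-- The defining relations of the universal DAHA of type `(C₁^∨, C₁)`. -/
inductive Rel (q : F) : FreeAlgebra F UDAHAGen → FreeAlgebra F UDAHAGen → Prop
  | mul_inv (i : Fin 4) : Rel q (ft F i * ftInv F i) 1
  | inv_mul (i : Fin 4) : Rel q (ftInv F i * ft F i) 1
  | central (i : Fin 4) (a : FreeAlgebra F UDAHAGen) :
      Rel q ((ft F i + ftInv F i) * a) (a * (ft F i + ftInv F i))
  | prod : Rel q (ft F 0 * ft F 1 * ft F 2 * ft F 3)
      (algebraMap F (FreeAlgebra F UDAHAGen) q⁻¹)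

end

end UDAHA

/-- The universal DAHA `Ĥ_q` of type `(C₁^∨, C₁)`: the `F`-algebra with generators `t_i^{±1}`
and relations `t_i t_i⁻¹ = t_i⁻¹ t_i = 1`, `t_i + t_i⁻¹` central, `t₀ t₁ t₂ t₃ = q⁻¹`. -/
abbrev UDAHA {F : Type*} [Field F] (q : F) : Type _ := RingQuot (UDAHA.Rel q)

namespace UDAHA

section

variable {F : Type*} [Field F]

/-- The generator `t_i` of `Ĥ_q`, as a unit with inverse the generator `t_i⁻¹`. -/
def t (q : F) (i : Fin 4) : (UDAHA q)ˣ where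
  val := RingQuot.mkAlgHom F (Rel q) (ft F i)
  inv := RingQuot.mkAlgHom F (Rel q) (ftInv F i)
  val_inv := by
    rw [← map_mul, RingQuot.mkAlgHom_rel F (Rel.mul_inv (q := q) i), map_one]
  inv_val := by
    rw [← map_mul, RingQuot.mkAlgHom_rel F (Rel.inv_mul (q := q) i), map_one]

/-- The element `T_i = t_i + t_i⁻¹` of `Ĥ_q`. -/
def T (q : F) (i : Fin 4) : UDAHA q :=
  (t q i : UDAHA q) + ((t q i)⁻¹ : (UDAHA q)ˣ)

/-- The invertible element `X = t₃ t₀` of `Ĥ_q`. -/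
def X (q : F) : (UDAHA q)ˣ := t q 3 * t q 0

/-- The invertible element `Y = t₀ t₁` of `Ĥ_q`. -/
def Y (q : F) : (UDAHA q)ˣ := t q 0 * t q 1

end

end UDAHA

/-! Let `R = F[T₀, T₁, T₂, T₃]` be a polynomial ring and `L = R[X^{±1}]`. Over `L` the elements `t₀`
and `t₁` behave like Hecke generators: `t f = s(f) t + der(f)`, where `s` inverts `Z` and `der f =
(aZ - b)(s f - f)/(Z⁻¹ - Z)`. For `t₀` one has `Z = X` and `(a, b) = (T₀, T₃)`; for `t₁` one has `Z
= t₁t₂ = (qX)⁻¹` and `(a, b) = (T₁, T₂)`. So `Ĥ_q` should be the free left `L`-module on the reduced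
words in `t₀, t₁`, that is, on the infinite dihedral group.

That module is constructed independently, with operators satisfying the defining relations (`rep`).
The map `h ↦ h e₀` (`repEval`) is injective: sending `f e_n` to `f(X)` times the reduced word of `n`
commutes with the action (`wordMap_rep`), and this map is a left inverse. Moreover the vectors `Yⁱ
Xʲ t₀ᵏ e₀` form an `R`-basis of the module (`chain_bijective`): in the filtration by length modulo
right multiplication by `s₀`, each power of `Y` carries the bottom piece onto one graded piece, and
every graded piece is reached exactly once. Independence of the basis vectors gives independence of
the elements `Yⁱ Xʲ t₀ᵏ`, and injectivity shows that these span.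

Multiplying by monomials in the `T_i` gives family (i). For (ii), the products `t₀ᵏ T₀^ℓ` with `k ∈
{0, 1}` are the images of `Tᵏ (T + T⁻¹)^ℓ`, which form a basis of `F[T;T⁻¹]`, just as the powers
`Tᵏ` with `k ∈ ℤ` do (`trace_bijective`). -/

open LaurentPolynomial in
/-- Evaluation of Laurent polynomials at a unit of a possibly noncommutative algebra. -/
noncomputable def LaurentPolynomial.evalUnit {R A : Type*} [CommSemiring R] [Semiring A]
    [Algebra R A] (u : Aˣ) : R[T;T⁻¹] →ₐ[R] A :=
  AddMonoidAlgebra.lift R A ℤ ((Units.coeHom A).comp (zpowersHom Aˣ u))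

open LaurentPolynomial in
@[simp]
theorem LaurentPolynomial.evalUnit_T {R A : Type*} [CommSemiring R] [Semiring A]
    [Algebra R A] (u : Aˣ) (n : ℤ) :
    evalUnit u (T n : R[T;T⁻¹]) = ((u ^ n : Aˣ) : A) := by
  rw [evalUnit, T, AddMonoidAlgebra.lift_single, one_smul]
  rfl

open LaurentPolynomial in
theorem LaurentPolynomial.induction_mul {R : Type*} [CommSemiring R] {P : R[T;T⁻¹] → Prop}
    (hC : ∀ r : R, P (algebraMap R _ r)) (hadd : ∀ f g, P f → P g → P (f + g))
    (hmul : ∀ f g, P f → P g → P (f * g)) (hT : P (T 1)) (hT' : P (T (-1))) (f : R[T;T⁻¹]) :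
    P f := by
  refine LaurentPolynomial.induction_on f hC (fun h₁ h₂ => hadd _ _ h₁ h₂) ?_ ?_
  · intro n a h
    rw [T_add, ← mul_assoc]
    exact hmul _ _ h hT
  · intro n a h
    rw [T_sub, ← mul_assoc]
    exact hmul _ _ h hT'

/-! ### Exchange data and the Hecke operators they define -/

/-- The data of an `R`-linear involution `s` of `L` inverting the unit `Z`, together with a twisted
derivation `der`; these describe the exchange relation `t f = s(f) t + der(f)` for a Hecke
generator `t` with `t + t⁻¹ = a` and `Z t⁻¹ + t Z⁻¹ = b`. -/
structure Demazure (R L : Type*) [CommRing R] [CommRing L] [Algebra R L] where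
  s : L →ₐ[R] L
  Z : Lˣ
  a : R
  b : R
  der : L →ₗ[R] L
  s_s : ∀ f, s (s f) = f
  s_Z : s Z = ((Z⁻¹ : Lˣ) : L)
  der_mul : ∀ f g, der (f * g) = s f * der g + der f * g
  der_Z : der Z = a • (Z : L) - algebraMap R L b
  der_der : ∀ f, der (der f) = a • der f
  s_der_add : ∀ f, s (der f) + der (s f) = a • (s f - f)

namespace Demazure

variable {R L : Type*} [CommRing R] [CommRing L] [Algebra R L]

/-- The derivation is `der f = (aZ - b)(s f - f)/(Z⁻¹ - Z)`. Each axiom is checked after clearing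
denominators, which is allowed in a domain; two factors are cleared for `der (der f)` because the
quotient is iterated. -/
theorem exists_of_dvd [IsDomain L] (s : L →ₐ[R] L) (Z : Lˣ) (a b : R) (s_s : ∀ f, s (s f) = f)
    (s_Z : s Z = ((Z⁻¹ : Lˣ) : L)) (hD : ((Z⁻¹ : Lˣ) : L) - Z ≠ 0)
    (hdvd : ∀ f, (((Z⁻¹ : Lˣ) : L) - Z) ∣ s f - f) :
    ∃ d : Demazure R L, d.s = s ∧ d.Z = Z ∧ d.a = a ∧ d.b = b := by
  choose δ hδ using hdvd
  set D : L := ((Z⁻¹ : Lˣ) : L) - Z with hDdef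
  set γ : L := a • (Z : L) - algebraMap R L b with hγ
  have s_Z' : s ((Z⁻¹ : Lˣ) : L) = Z := by rw [← s_Z, s_s]
  have sD : s D = -D := by simp [hDdef, s_Z, s_Z']
  have sγ : s γ = γ + algebraMap R L a * D := by
    simp [hDdef, hγ, s_Z, Algebra.smul_def]; ring
  let der : L →ₗ[R] L :=
    { toFun := fun f => γ * δ f
      map_add' := fun f g => mul_left_cancel₀ hD (by
        have h := hδ (f + g)
        rw [map_add] at h
        linear_combination γ * (hδ f + hδ g - h))
      map_smul' := fun r f => mul_left_cancel₀ hD (by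
        have h := hδ (r • f)
        rw [map_smul] at h
        simp only [Algebra.smul_def, RingHom.id_apply] at h ⊢
        linear_combination γ * (algebraMap R L r * hδ f - h)) }
  have hder : ∀ f, D * der f = γ * (s f - f) := fun f => by
    change D * (γ * δ f) = _
    rw [hδ f]; ring
  have hsder : ∀ f, D * s (der f) = s γ * (s f - f) := fun f => by
    have h := congrArg s (hder f)
    rw [map_mul s, map_mul s, map_sub s (s f) f, s_s, sD] at h
    linear_combination -h
  refine ⟨⟨s, Z, a, b, der, s_s, s_Z, ?_, ?_, ?_, ?_⟩, rfl, rfl, rfl, rfl⟩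
  · intro f g
    refine mul_left_cancel₀ hD ?_
    have h := hder (f * g)
    rw [map_mul s] at h
    linear_combination h - s f * hder g - g * hder f
  · refine mul_left_cancel₀ hD ?_
    rw [hder, s_Z, mul_comm]
  · intro f
    refine mul_left_cancel₀ hD (mul_left_cancel₀ hD ?_)
    rw [Algebra.smul_def]
    linear_combination D * hder (der f) + γ * hsder f - γ * hder f
      + γ * (s f - f) * sγ - D * algebraMap R L a * hder f
  · intro f
    refine mul_left_cancel₀ hD ?_
    have h := hder (s f)
    rw [s_s] at h
    rw [Algebra.smul_def]
    linear_combination hsder f + h + (s f - f) * sγ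

section HeckeOp

variable {ι : Type*} (d : Demazure R L) (π : ι → ι) (hi : ι → Bool)

/-- The action of a Hecke generator on the free `L`-module on `ι`, where `π` is left
multiplication by the corresponding reflection and `hi n` says that `n` is longer than `π n`. -/
noncomputable def heckeOp : Module.End R (ι →₀ L) :=
  Finsupp.lsum R fun n =>
    Finsupp.lsingle n ∘ₗ (d.der + if hi n then d.a • d.s.toLinearMap else 0) +
      Finsupp.lsingle (π n) ∘ₗ (if hi n then -d.s.toLinearMap else d.s.toLinearMap)

variable {hi}

theorem heckeOp_lo {n : ι} (h : hi n = false) (f : L) :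
    d.heckeOp π hi (Finsupp.single n f) =
      Finsupp.single n (d.der f) + Finsupp.single (π n) (d.s f) := by
  simp [heckeOp, h]

theorem heckeOp_hi {n : ι} (h : hi n = true) (f : L) :
    d.heckeOp π hi (Finsupp.single n f) =
      Finsupp.single n (d.der f + d.a • d.s f) - Finsupp.single (π n) (d.s f) := by
  simp [heckeOp, h, sub_eq_add_neg]

variable {π} (hπ : ∀ n, π (π n) = n) (hhi : ∀ n, hi (π n) = !hi n)
include hπ hhi

/-- The quadratic relation `t² = a t - 1`, which makes the operator invertible. The pair `{n, π n}`
spans an invariant submodule; there `der_der` handles one coordinate and `s_der_add` the other. -/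
theorem heckeOp_heckeOp (m : ι →₀ L) :
    d.heckeOp π hi (d.heckeOp π hi m) = d.a • d.heckeOp π hi m - m := by
  induction m using Finsupp.induction_linear with
  | zero => simp
  | add x y hx hy => simp only [map_add, hx, hy, smul_add]; abel
  | single n f =>
    cases h : hi n
    · have h' : hi (π n) = true := by rw [hhi, h]; rfl
      rw [heckeOp_lo d π h, map_add, heckeOp_lo d π h, heckeOp_hi d π h', d.der_der, d.s_s, hπ,
        smul_add, Finsupp.smul_single, Finsupp.smul_single]
      have e : d.der (d.s f) = d.a • (d.s f - f) - d.s (d.der f) := by rw [← d.s_der_add]; abel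
      rw [e, smul_sub]
      simp only [Finsupp.single_add, Finsupp.single_sub]
      abel
    · have h' : hi (π n) = false := by rw [hhi, h]; rfl
      rw [heckeOp_hi d π h, map_sub, heckeOp_hi d π h, heckeOp_lo d π h', hπ]
      have e : d.der (d.s f) = d.a • (d.s f - f) - d.s (d.der f) := by rw [← d.s_der_add]; abel
      simp only [map_add, map_smul, d.der_der, d.s_s, e, smul_sub, smul_add, Finsupp.single_add,
        Finsupp.single_sub, Finsupp.smul_single]
      abel

omit hπ hhi in
theorem heckeOp_smul (f : L) (m : ι →₀ L) :
    d.heckeOp π hi (f • m) = d.s f • d.heckeOp π hi m + d.der f • m := by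
  induction m using Finsupp.induction_linear with
  | zero => simp
  | add x y hx hy => simp only [map_add, hx, hy, smul_add]; abel
  | single n g =>
    cases h : hi n
    · simp only [Finsupp.smul_single, smul_eq_mul, heckeOp_lo d π h, d.der_mul, map_mul, smul_add,
        Finsupp.single_add]
      abel
    · simp only [Finsupp.smul_single, smul_eq_mul, heckeOp_hi d π h, d.der_mul, map_mul, smul_add,
        Finsupp.single_add, smul_sub, mul_smul_comm]
      abel

/-- The Hecke operator as a unit of the endomorphism ring, with inverse `a - t`. -/
noncomputable def heckeUnit : (Module.End R (ι →₀ L))ˣ where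
  val := d.heckeOp π hi
  inv := algebraMap R _ d.a - d.heckeOp π hi
  val_inv := by
    refine LinearMap.ext fun m => ?_
    simp [heckeOp_heckeOp d hπ hhi, Module.algebraMap_end_apply]
  inv_val := by
    refine LinearMap.ext fun m => ?_
    simp [heckeOp_heckeOp d hπ hhi, Module.algebraMap_end_apply]

end HeckeOp

end Demazure

/-! ### Reflections of a Laurent polynomial ring -/

namespace LaurentPolynomial

section

variable {R : Type*} [CommRing R]

/-- The unit `c * T 1` of the Laurent polynomial ring. -/
noncomputable def scaledUnit (c : Rˣ) : (R[T;T⁻¹])ˣ where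
  val := algebraMap R _ (c : R) * T 1
  inv := algebraMap R _ ((c⁻¹ : Rˣ) : R) * T (-1)
  val_inv := by
    rw [mul_mul_mul_comm, ← map_mul, ← T_add]
    simp
  inv_val := by
    rw [mul_mul_mul_comm, ← map_mul, ← T_add]
    simp

theorem T_one_eq_scaledUnit (c : Rˣ) :
    (T 1 : R[T;T⁻¹]) = algebraMap R _ ((c⁻¹ : Rˣ) : R) * (scaledUnit c : R[T;T⁻¹]) := by
  simp [scaledUnit, ← mul_assoc, ← map_mul]

theorem T_neg_one_eq_scaledUnit (c : Rˣ) :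
    (T (-1) : R[T;T⁻¹]) =
      algebraMap R _ (c : R) * (((scaledUnit c)⁻¹ : (R[T;T⁻¹])ˣ) : R[T;T⁻¹]) := by
  simp [scaledUnit, ← mul_assoc, ← map_mul]

theorem scaledUnit_induction (c : Rˣ) {P : R[T;T⁻¹] → Prop}
    (hC : ∀ r : R, P (algebraMap R _ r)) (hadd : ∀ f g, P f → P g → P (f + g))
    (hmul : ∀ f g, P f → P g → P (f * g)) (hZ : P (scaledUnit c))
    (hZ' : P ((scaledUnit c)⁻¹ : (R[T;T⁻¹])ˣ)) (f : R[T;T⁻¹]) : P f :=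
  induction_mul hC hadd hmul (T_one_eq_scaledUnit c ▸ hmul _ _ (hC _) hZ)
    (T_neg_one_eq_scaledUnit c ▸ hmul _ _ (hC _) hZ') f

/-- The involution `c T ↦ (c T)⁻¹` of the Laurent polynomial ring. -/
noncomputable def scaledInvert (c : Rˣ) : R[T;T⁻¹] →ₐ[R] R[T;T⁻¹] :=
  -- `c T ↦ (c T)⁻¹` is the same as `T ↦ (c² T)⁻¹`.
  evalUnit (scaledUnit (c ^ 2))⁻¹

theorem scaledInvert_scaledUnit (c : Rˣ) :
    scaledInvert c (scaledUnit c) = (((scaledUnit c)⁻¹ : (R[T;T⁻¹])ˣ) : R[T;T⁻¹]) := by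
  have h : (scaledUnit c : R[T;T⁻¹]) = algebraMap R _ (c : R) * T 1 := rfl
  have h1 : (((scaledUnit (c ^ 2))⁻¹ : (R[T;T⁻¹])ˣ) : R[T;T⁻¹]) =
    algebraMap R R[T;T⁻¹] (((c ^ 2)⁻¹ : Rˣ) : R) * T (-1) := rfl
  have h2 : (((scaledUnit c)⁻¹ : (R[T;T⁻¹])ˣ) : R[T;T⁻¹]) =
    algebraMap R R[T;T⁻¹] ((c⁻¹ : Rˣ) : R) * T (-1) := rfl
  rw [h, map_mul, AlgHom.commutes, scaledInvert, evalUnit_T, zpow_one, h1, h2, ← mul_assoc,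
    ← map_mul, ← Units.val_mul]
  congr 4
  group

theorem scaledInvert_scaledUnit_inv (c : Rˣ) :
    scaledInvert c (((scaledUnit c)⁻¹ : (R[T;T⁻¹])ˣ) : R[T;T⁻¹]) = scaledUnit c := by
  have h : Units.map (scaledInvert c : R[T;T⁻¹] →* R[T;T⁻¹]) (scaledUnit c) = (scaledUnit c)⁻¹ :=
    Units.ext (scaledInvert_scaledUnit c)
  have h' := congrArg (fun u => ((u⁻¹ : (R[T;T⁻¹])ˣ) : R[T;T⁻¹])) h
  simpa using h'

theorem scaledInvert_scaledInvert (c : Rˣ) (f : R[T;T⁻¹]) :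
    scaledInvert c (scaledInvert c f) = f := by
  refine scaledUnit_induction c (P := fun f => scaledInvert c (scaledInvert c f) = f)
    ?_ ?_ ?_ ?_ ?_ f
  · intro r; simp only [AlgHom.commutes]
  · intro f g hf hg; rw [map_add, map_add, hf, hg]
  · intro f g hf hg; rw [map_mul, map_mul, hf, hg]
  · rw [scaledInvert_scaledUnit, scaledInvert_scaledUnit_inv]
  · rw [scaledInvert_scaledUnit_inv, scaledInvert_scaledUnit]

/-- The map `f ↦ s f - f` is a twisted derivation, so the `f` satisfying the divisibility are closed
under sums and products; on `c T` and its inverse it gives plus or minus the divisor itself. -/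
theorem dvd_scaledInvert_sub (c : Rˣ) (f : R[T;T⁻¹]) :
    (((scaledUnit c)⁻¹ : (R[T;T⁻¹])ˣ) : R[T;T⁻¹]) - scaledUnit c ∣ scaledInvert c f - f := by
  refine scaledUnit_induction c (P := fun f => (((scaledUnit c)⁻¹ : (R[T;T⁻¹])ˣ) : R[T;T⁻¹]) -
    scaledUnit c ∣ scaledInvert c f - f) ?_ ?_ ?_ ?_ ?_ f
  · intro r; simp only [AlgHom.commutes, sub_self, dvd_zero]
  · intro f g hf hg
    rw [map_add, add_sub_add_comm]
    exact dvd_add hf hg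
  · intro f g hf hg
    have : scaledInvert c (f * g) - f * g =
        scaledInvert c f * (scaledInvert c g - g) + (scaledInvert c f - f) * g := by
      rw [map_mul]; ring
    rw [this]
    exact dvd_add (hg.mul_left _) (hf.mul_right _)
  · rw [scaledInvert_scaledUnit]
  · rw [scaledInvert_scaledUnit_inv, ← neg_sub, neg_dvd]

theorem scaledUnit_inv_sub_ne_zero [Nontrivial R] (c : Rˣ) :
    (((scaledUnit c)⁻¹ : (R[T;T⁻¹])ˣ) : R[T;T⁻¹]) - scaledUnit c ≠ 0 := by
  intro h
  have h' := congrArg (fun f : R[T;T⁻¹] => f.coeff 1) h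
  have e : (((scaledUnit c)⁻¹ : (R[T;T⁻¹])ˣ) : R[T;T⁻¹]) - (scaledUnit c : R[T;T⁻¹]) =
    C ((c⁻¹ : Rˣ) : R) * T (-1) - C (c : R) * T 1 := rfl
  rw [e, ← single_eq_C_mul_T, ← single_eq_C_mul_T, AddMonoidAlgebra.coeff_sub] at h'
  simp [AddMonoidAlgebra.coeff_single, -single_eq_C_mul_T] at h'

end

end LaurentPolynomial

namespace Demazure

open LaurentPolynomial

variable {R : Type*} [CommRing R] [IsDomain R]

theorem exists_scaledUnit (c : Rˣ) (a b : R) :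
    ∃ d : Demazure R R[T;T⁻¹],
      d.s = scaledInvert c ∧ d.Z = scaledUnit c ∧ d.a = a ∧ d.b = b :=
  exists_of_dvd _ _ a b (scaledInvert_scaledInvert c) (scaledInvert_scaledUnit c)
    (scaledUnit_inv_sub_ne_zero c) (dvd_scaledInvert_sub c)

theorem exists_scaledUnit_inv (c : Rˣ) (a b : R) :
    ∃ d : Demazure R R[T;T⁻¹],
      d.s = scaledInvert c ∧ d.Z = (scaledUnit c)⁻¹ ∧ d.a = a ∧ d.b = b :=
  exists_of_dvd _ _ a b (scaledInvert_scaledInvert c)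
    (by rw [scaledInvert_scaledUnit_inv, inv_inv])
    (by rw [inv_inv, ← neg_sub, neg_ne_zero]; exact scaledUnit_inv_sub_ne_zero c)
    (by intro f; rw [inv_inv, ← neg_sub, neg_dvd]; exact dvd_scaledInvert_sub c f)

/-- The exchange datum for `t₀`, with `Z = X`. -/
noncomputable def ofUnit (c : Rˣ) (a b : R) : Demazure R R[T;T⁻¹] :=
  (exists_scaledUnit c a b).choose

/-- The exchange datum for `t₁`, with `Z = (c X)⁻¹`. -/
noncomputable def ofUnitInv (c : Rˣ) (a b : R) : Demazure R R[T;T⁻¹] :=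
  (exists_scaledUnit_inv c a b).choose

@[simp] theorem ofUnit_Z (c : Rˣ) (a b : R) : (ofUnit c a b).Z = scaledUnit c :=
  (exists_scaledUnit c a b).choose_spec.2.1

@[simp] theorem ofUnit_a (c : Rˣ) (a b : R) : (ofUnit c a b).a = a :=
  (exists_scaledUnit c a b).choose_spec.2.2.1

@[simp] theorem ofUnit_b (c : Rˣ) (a b : R) : (ofUnit c a b).b = b :=
  (exists_scaledUnit c a b).choose_spec.2.2.2

@[simp] theorem ofUnitInv_Z (c : Rˣ) (a b : R) : (ofUnitInv c a b).Z = (scaledUnit c)⁻¹ :=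
  (exists_scaledUnit_inv c a b).choose_spec.2.1

@[simp] theorem ofUnitInv_a (c : Rˣ) (a b : R) : (ofUnitInv c a b).a = a :=
  (exists_scaledUnit_inv c a b).choose_spec.2.2.1

@[simp] theorem ofUnitInv_b (c : Rˣ) (a b : R) : (ofUnitInv c a b).b = b :=
  (exists_scaledUnit_inv c a b).choose_spec.2.2.2

end Demazure

/-! ### Exchange relations in an algebra and for the Hecke operators -/

namespace Demazure

variable {R L : Type*} [CommRing R] [CommRing L] [Algebra R L] (d : Demazure R L)

theorem der_one : d.der 1 = 0 := by
  simpa using d.der_mul 1 1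

theorem s_mul_der_inv (u : Lˣ) :
    d.s u * d.der ((u⁻¹ : Lˣ) : L) = -(d.der u * ((u⁻¹ : Lˣ) : L)) := by
  have h := d.der_mul u ((u⁻¹ : Lˣ) : L)
  rw [Units.mul_inv, der_one] at h
  linear_combination -h

section Exchange

variable {A : Type*} [Ring A] [Algebra R A] (ev : L →ₐ[R] A) (t : Aˣ)

/-- `t` satisfies the exchange relation with `f`. -/
def Exchanges (f : L) : Prop := (t : A) * ev f = ev (d.s f) * t + ev (d.der f)

variable {d ev t}

theorem Exchanges.of_algebraMap (r : R) : Exchanges d ev t (algebraMap R L r) := by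
  have h : d.der (algebraMap R L r) = 0 := by
    rw [Algebra.algebraMap_eq_smul_one, map_smul, der_one, smul_zero]
  simp only [Exchanges, AlgHom.commutes, h, map_zero, add_zero, Algebra.commutes r (t : A)]

theorem Exchanges.add {f g : L} (hf : Exchanges d ev t f) (hg : Exchanges d ev t g) :
    Exchanges d ev t (f + g) := by
  rw [Exchanges] at *
  simp only [map_add, mul_add, hf, hg, add_mul]
  abel

theorem Exchanges.mul {f g : L} (hf : Exchanges d ev t f) (hg : Exchanges d ev t g) :
    Exchanges d ev t (f * g) := by
  rw [Exchanges] at *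
  rw [map_mul, ← mul_assoc, hf, add_mul, mul_assoc, hg, d.der_mul]
  simp only [map_add, map_mul, mul_add, mul_assoc]
  abel

/-- With `add` and `mul`, this reduces the exchange relation on all Laurent polynomials to the
single element `Z`. One cancels the unit `ev (s u)` and uses the Leibniz rule for `u u⁻¹ = 1`. -/
theorem Exchanges.inv {u : Lˣ} (hu : Exchanges d ev t u) :
    Exchanges d ev t ((u⁻¹ : Lˣ) : L) := by
  rw [Exchanges] at *
  have hs : IsUnit (ev (d.s u)) := (u.isUnit.map d.s).map ev
  have hss : ev (d.s u) * ev (d.s ((u⁻¹ : Lˣ) : L)) = 1 := by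
    rw [← map_mul, ← map_mul, Units.mul_inv, map_one, map_one]
  have huu : ev u * ev ((u⁻¹ : Lˣ) : L) = 1 := by
    rw [← map_mul, Units.mul_inv, map_one]
  refine hs.mul_left_cancel ?_
  rw [mul_add, ← mul_assoc (ev (d.s u)) _ (t : A), hss, one_mul, ← map_mul, s_mul_der_inv, map_neg,
    map_mul, ← mul_assoc, eq_sub_of_add_eq hu.symm, sub_mul, mul_assoc, huu, mul_one, sub_eq_add_neg]

theorem exchanges_Z (ht : (t : A) + ((t⁻¹ : Aˣ) : A) = algebraMap R A d.a)
    (hZ : ev d.Z * ((t⁻¹ : Aˣ) : A) + t * ev ((d.Z⁻¹ : Lˣ) : L) = algebraMap R A d.b) :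
    Exchanges d ev t d.Z := by
  rw [Exchanges, d.s_Z, d.der_Z]
  have hzz : ev d.Z * ev ((d.Z⁻¹ : Lˣ) : L) = 1 := by rw [← map_mul, Units.mul_inv, map_one]
  have hzz' : ev ((d.Z⁻¹ : Lˣ) : L) * ev d.Z = 1 := by rw [← map_mul, Units.inv_mul, map_one]
  rw [← eq_sub_iff_add_eq'] at ht
  rw [ht] at hZ
  -- After `t⁻¹ = a - t`, multiplying by `Z⁻¹` on the left and `Z` on the right turns the hypothesis
  -- into `a Z - t Z + Z⁻¹ t = b`.
  have h := congrArg (fun y => ev ((d.Z⁻¹ : Lˣ) : L) * y * ev d.Z) hZ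
  simp only [mul_add, add_mul, mul_sub, sub_mul] at h
  rw [← mul_assoc, hzz', one_mul, ← mul_assoc, hzz', one_mul, ← Algebra.commutes,
    mul_assoc (algebraMap R A d.b), hzz', mul_one, mul_assoc, mul_assoc, hzz', mul_one] at h
  rw [map_sub, AlgHom.commutes, map_smul, Algebra.smul_def, ← h]
  abel

end Exchange

section HeckeRel

variable {ι : Type*} {π : ι → ι} {hi : ι → Bool}
  (hπ : ∀ n, π (π n) = n) (hhi : ∀ n, hi (π n) = !hi n)

theorem heckeUnit_add_inv :
    (d.heckeUnit hπ hhi : Module.End R (ι →₀ L)) + ((d.heckeUnit hπ hhi)⁻¹ : (Module.End R (ι →₀ L))ˣ)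
      = algebraMap R _ d.a := by
  change d.heckeOp π hi + (algebraMap R _ d.a - d.heckeOp π hi) = _
  abel

/-- The converse of `exchanges_Z` for the operators. It will show that `t₃ = X t₀⁻¹` and, after
conjugation, `t₂ = t₁⁻¹ (qX)⁻¹` have scalar sums with their inverses. -/
theorem lsmul_Z_mul_heckeUnit_inv_add :
    Algebra.lsmul R R (ι →₀ L) (d.Z : L) *
        (((d.heckeUnit hπ hhi)⁻¹ : (Module.End R (ι →₀ L))ˣ) : Module.End R (ι →₀ L)) +
      (d.heckeUnit hπ hhi : Module.End R (ι →₀ L)) *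
        Algebra.lsmul R R (ι →₀ L) ((d.Z⁻¹ : Lˣ) : L) = algebraMap R _ d.b := by
  change Algebra.lsmul R R (ι →₀ L) (d.Z : L) * (algebraMap R _ d.a - d.heckeOp π hi) +
    d.heckeOp π hi * Algebra.lsmul R R (ι →₀ L) ((d.Z⁻¹ : Lˣ) : L) = _
  have hs : d.s ((d.Z⁻¹ : Lˣ) : L) = d.Z := by rw [← d.s_Z, d.s_s]
  have hder : d.der ((d.Z⁻¹ : Lˣ) : L) = algebraMap R L d.b - d.a • (d.Z : L) := by
    refine d.Z⁻¹.isUnit.mul_left_cancel ?_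
    have h := d.s_mul_der_inv d.Z
    rw [d.s_Z, d.der_Z] at h
    rw [h]
    ring
  refine LinearMap.ext fun m => ?_
  simp [Module.algebraMap_end_apply, heckeOp_smul, hs, hder, smul_sub, sub_smul,
    smul_comm d.a (d.Z : L)]
  abel

end HeckeRel

end Demazure

/-! ### The infinite dihedral group as a chain of integers -/

namespace DihedralChain

/-- Left multiplication by the reflection `s₀`, pairing `2m - 1` with `2m`. -/
def refl₀ (n : ℤ) : ℤ := if n % 2 = 0 then n - 1 else n + 1

/-- Left multiplication by the reflection `s₁`, pairing `2m` with `2m + 1`. -/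
def refl₁ (n : ℤ) : ℤ := if n % 2 = 0 then n + 1 else n - 1

/-- Whether `s₀` shortens the group element. -/
def short₀ (n : ℤ) : Bool := if n % 2 = 0 then decide (0 < n) else decide (n < 0)

/-- Whether `s₁` shortens the group element. -/
def short₁ (n : ℤ) : Bool := if n % 2 = 0 then decide (n < 0) else decide (0 < n)

theorem refl₀_refl₀ (n : ℤ) : refl₀ (refl₀ n) = n := by
  simp only [refl₀]; split_ifs <;> omega

theorem refl₁_refl₁ (n : ℤ) : refl₁ (refl₁ n) = n := by
  simp only [refl₁]; split_ifs <;> omega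

theorem short₀_refl₀ (n : ℤ) : short₀ (refl₀ n) = !short₀ n := by
  simp only [refl₀, short₀]
  split_ifs <;> first | omega | (rw [← decide_not, decide_eq_decide]; omega)

theorem short₁_refl₁ (n : ℤ) : short₁ (refl₁ n) = !short₁ n := by
  simp only [refl₁, short₁]
  split_ifs <;> first | omega | (rw [← decide_not, decide_eq_decide]; omega)

variable {A : Type*} [Ring A] (t₀ t₁ : A)

/-- The alternating word of length `n` ending with `t₁`. -/
def halfWord : ℕ → A
  | 0 => 1
  | n + 1 => (if n % 2 = 0 then t₁ else t₀) * halfWord n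

/-- The reduced word of the group element indexed by `n`. -/
def word : ℤ → A
  | Int.ofNat n => halfWord t₀ t₁ n
  | Int.negSucc n => halfWord t₀ t₁ n * t₀

/-- The hypothesis says that `s₀` lengthens `n`: the word of `n` is empty or begins with `t₁`, so
prefixing `t₀` keeps it alternating. -/
theorem mul_word₀ {n : ℤ} (h : short₀ n = false) :
    t₀ * word t₀ t₁ n = word t₀ t₁ (refl₀ n) := by
  rcases n with m | m
  · rcases Nat.eq_zero_or_pos m with rfl | hm
    · change t₀ * 1 = 1 * t₀
      rw [mul_one, one_mul]
    · have hm2 : ¬ ((m : ℤ) % 2 = 0) := by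
        intro h2
        simp [short₀, h2] at h
        omega
      have e : refl₀ (Int.ofNat m) = Int.ofNat (m + 1) := by simp [refl₀, hm2]
      rw [e]
      simp only [word, halfWord]
      rw [if_neg (by omega)]
  · have hm2 : Int.negSucc m % 2 = 0 := by
      by_contra h2
      simp only [short₀, h2, if_false, decide_eq_false_iff_not] at h
      omega
    have e : refl₀ (Int.negSucc m) = Int.negSucc (m + 1) := by
      simp only [refl₀, hm2, if_true]; omega
    rw [e]
    simp only [word, halfWord]
    rw [if_neg (by omega), mul_assoc]

theorem mul_word₁ {n : ℤ} (h : short₁ n = false) :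
    t₁ * word t₀ t₁ n = word t₀ t₁ (refl₁ n) := by
  rcases n with m | m
  · have hm2 : (m : ℤ) % 2 = 0 := by
      by_contra h2
      simp only [short₁, Int.ofNat_eq_natCast, h2, if_false, decide_eq_false_iff_not] at h
      omega
    have e : refl₁ (Int.ofNat m) = Int.ofNat (m + 1) := by simp [refl₁, hm2]
    rw [e]
    simp only [word, halfWord]
    rw [if_pos (by omega)]
  · have hm2 : ¬ (Int.negSucc m % 2 = 0) := by
      intro h2
      simp only [short₁, h2, if_true, decide_eq_false_iff_not] at h
      omega
    have e : refl₁ (Int.negSucc m) = Int.negSucc (m + 1) := by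
      simp only [refl₁, hm2, if_false]; omega
    rw [e]
    simp only [word, halfWord]
    rw [if_pos (by omega), mul_assoc]

end DihedralChain

/-! ### The map from the free module to the algebra -/

namespace Demazure

section WordMap

variable {R L A ι : Type*} [CommRing R] [CommRing L] [Algebra R L] [Ring A] [Algebra R A]
  (ev : L →ₐ[R] A) (w : ι → A)

/-- The map sending `f e_n` to `ev f * w n`. -/
noncomputable def wordMap : (ι →₀ L) →ₗ[R] A :=
  Finsupp.lsum R fun n => LinearMap.mulRight R (w n) ∘ₗ ev.toLinearMap

@[simp]
theorem wordMap_single (n : ι) (f : L) : wordMap ev w (Finsupp.single n f) = ev f * w n := by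
  simp [wordMap]

theorem wordMap_smul (f : L) (m : ι →₀ L) : wordMap ev w (f • m) = ev f * wordMap ev w m := by
  induction m using Finsupp.induction_linear with
  | zero => simp
  | add x y hx hy => simp only [smul_add, map_add, hx, hy, mul_add]
  | single n g =>
    rw [Finsupp.smul_single, smul_eq_mul, wordMap_single, wordMap_single, map_mul, mul_assoc]

variable {ev w}

theorem wordMap_heckeOp {d : Demazure R L} {π : ι → ι} {hi : ι → Bool} {t : Aˣ}
    (hπ : ∀ n, π (π n) = n) (hhi : ∀ n, hi (π n) = !hi n) (hex : ∀ f, Exchanges d ev t f)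
    (ht : (t : A) + ((t⁻¹ : Aˣ) : A) = algebraMap R A d.a)
    (hw : ∀ n, hi n = false → t * w n = w (π n)) (m : ι →₀ L) :
    wordMap ev w (d.heckeOp π hi m) = t * wordMap ev w m := by
  induction m using Finsupp.induction_linear with
  | zero => simp
  | add x y hx hy => simp only [map_add, hx, hy, mul_add]
  | single n f =>
    have hf := hex f
    rw [Exchanges] at hf
    cases h : hi n
    · rw [heckeOp_lo d π h, map_add, wordMap_single, wordMap_single, wordMap_single, ← mul_assoc,
        hf, add_mul, mul_assoc, hw n h]
      abel
    · have h' : hi (π n) = false := by rw [hhi, h]; rfl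
      -- In the shortening case `w n = t * w (π n)`, and `t = a - t⁻¹` removes the extra letter.
      have h1 : (t : A) * w n = d.a • w n - w (π n) := by
        have h2 := hw _ h'
        rw [hπ] at h2
        rw [Algebra.smul_def, ← ht, add_mul, ← h2, Units.inv_mul_cancel_left, add_sub_cancel_right]
      rw [heckeOp_hi d π h, map_sub, wordMap_single, wordMap_single, wordMap_single, ← mul_assoc,
        hf, add_mul, mul_assoc _ (t : A), h1, map_add, map_smul, mul_sub, add_mul, mul_smul_comm,
        smul_mul_assoc]
      abel

end WordMap

end Demazure

/-! ### Universal property and central elements of `Ĥ_q` -/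

namespace UDAHA

variable {F : Type*} [Field F] {q : F}

section Lift

variable {A : Type*} [Ring A] [Algebra F A] (τ : Fin 4 → Aˣ)
  (hc : ∀ i (a : A), ((τ i : A) + ((τ i)⁻¹ : Aˣ)) * a = a * ((τ i : A) + ((τ i)⁻¹ : Aˣ)))
  (hprod : (τ 0 * τ 1 * τ 2 * τ 3 : A) = algebraMap F A q⁻¹)

/-- The value on free generators of the map determined by units `τ i`. -/
def genVal : UDAHAGen → A
  | .t i => τ i
  | .tInv i => ((τ i)⁻¹ : Aˣ)

include hc hprod in
theorem lift_rel ⦃x y : FreeAlgebra F UDAHAGen⦄ (h : Rel q x y) :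
    FreeAlgebra.lift F (genVal τ) x = FreeAlgebra.lift F (genVal τ) y := by
  induction h with
  | mul_inv i => simp [ft, ftInv, genVal]
  | inv_mul i => simp [ft, ftInv, genVal]
  | central i a => simpa [ft, ftInv, genVal] using hc i _
  | prod => simpa [ft, ftInv, genVal] using hprod

/-- The algebra map out of `UDAHA q` determined by units satisfying the relations. -/
noncomputable def lift : UDAHA q →ₐ[F] A :=
  RingQuot.liftAlgHom F ⟨FreeAlgebra.lift F (genVal τ), lift_rel τ hc hprod⟩

theorem lift_t (i : Fin 4) : lift τ hc hprod (t q i : UDAHA q) = τ i := by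
  change RingQuot.liftAlgHom F _ (RingQuot.mkAlgHom F (Rel q) (ft F i)) = _
  rw [RingQuot.liftAlgHom_mkAlgHom_apply]
  simp [ft, genVal]

theorem map_lift_t (i : Fin 4) :
    Units.map (lift τ hc hprod : UDAHA q →* A) (t q i) = τ i :=
  Units.ext (lift_t τ hc hprod i)

end Lift

theorem induction {P : UDAHA q → Prop} (halg : ∀ r : F, P (algebraMap F _ r))
    (ht : ∀ i, P (t q i)) (ht' : ∀ i, P ((t q i)⁻¹ : (UDAHA q)ˣ))
    (hadd : ∀ x y, P x → P y → P (x + y)) (hmul : ∀ x y, P x → P y → P (x * y))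
    (h : UDAHA q) : P h := by
  obtain ⟨x, rfl⟩ := RingQuot.mkAlgHom_surjective F (Rel q) h
  induction x using FreeAlgebra.induction with
  | grade0 r => rw [AlgHom.commutes]; exact halg r
  | grade1 g =>
    cases g with
    | t i => exact ht i
    | tInv i => exact ht' i
  | mul x y hx hy => rw [map_mul]; exact hmul _ _ hx hy
  | add x y hx hy => rw [map_add]; exact hadd _ _ hx hy

theorem T_mul_comm (i : Fin 4) (h : UDAHA q) : T q i * h = h * T q i := by
  obtain ⟨x, rfl⟩ := RingQuot.mkAlgHom_surjective F (Rel q) h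
  have := RingQuot.mkAlgHom_rel F (Rel.central (q := q) i x)
  simp only [map_mul, map_add] at this
  exact this

theorem prod_t : (t q 0 * t q 1 * t q 2 * t q 3 : UDAHA q) = algebraMap F _ q⁻¹ := by
  have := RingQuot.mkAlgHom_rel F (Rel.prod (q := q))
  simp only [map_mul, AlgHom.commutes] at this
  exact this

end UDAHA

/-! ### The representation on the dihedral module and its faithfulness -/

namespace UDAHA

open LaurentPolynomial DihedralChain Demazure

section Rep

variable {R : Type*} [CommRing R]

/-- The action of Laurent polynomial units on the free module on the infinite dihedral group. -/
noncomputable def mulUnit : (R[T;T⁻¹])ˣ →* (Module.End R (ℤ →₀ R[T;T⁻¹]))ˣ :=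
  Units.map
    ((Algebra.lsmul R R (ℤ →₀ R[T;T⁻¹]) : R[T;T⁻¹] →ₐ[R] Module.End R (ℤ →₀ R[T;T⁻¹])) :
      R[T;T⁻¹] →* Module.End R (ℤ →₀ R[T;T⁻¹]))

theorem mulUnit_val (u : (R[T;T⁻¹])ˣ) :
    (mulUnit u : Module.End R (ℤ →₀ R[T;T⁻¹])) =
      Algebra.lsmul R R (ℤ →₀ R[T;T⁻¹]) (u : R[T;T⁻¹]) := rfl

variable [IsDomain R] (c : Rˣ) (a : Fin 4 → R)

/-- The operator by which `t₀` acts. -/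
noncomputable def op₀ : (Module.End R (ℤ →₀ R[T;T⁻¹]))ˣ :=
  (ofUnit 1 (a 0) (a 3)).heckeUnit refl₀_refl₀ short₀_refl₀

/-- The operator by which `t₁` acts. -/
noncomputable def op₁ : (Module.End R (ℤ →₀ R[T;T⁻¹]))ˣ :=
  (ofUnitInv c (a 1) (a 2)).heckeUnit refl₁_refl₁ short₁_refl₁

/-- The operators by which `t₀, t₁, t₂, t₃` act. -/
noncomputable def op : Fin 4 → (Module.End R (ℤ →₀ R[T;T⁻¹]))ˣ :=
  ![op₀ a, op₁ c a, (op₁ c a)⁻¹ * mulUnit (scaledUnit c)⁻¹, mulUnit (scaledUnit 1) * (op₀ a)⁻¹]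

/-- Each sum acts as a scalar of `R`, hence is central among `R`-linear operators. For `i = 0, 1`
this is the quadratic relation; for `i = 2, 3` it is `lsmul_Z_mul_heckeUnit_inv_add`. -/
theorem op_add_inv (i : Fin 4) :
    (op c a i : Module.End R (ℤ →₀ R[T;T⁻¹])) +
      (((op c a i)⁻¹ : (Module.End R (ℤ →₀ R[T;T⁻¹]))ˣ) : Module.End R (ℤ →₀ R[T;T⁻¹])) =
      algebraMap R _ (a i) := by
  fin_cases i
  · exact (heckeUnit_add_inv _ refl₀_refl₀ short₀_refl₀).trans (by simp)
  · exact (heckeUnit_add_inv _ refl₁_refl₁ short₁_refl₁).trans (by simp)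
  · have h := lsmul_Z_mul_heckeUnit_inv_add (ofUnitInv c (a 1) (a 2)) refl₁_refl₁ short₁_refl₁
    rw [ofUnitInv_b, ofUnitInv_Z, inv_inv] at h
    change Algebra.lsmul R R _ _ * ((op₁ c a)⁻¹).val + (op₁ c a).val * _ = _ at h
    change ((op₁ c a)⁻¹ * mulUnit (scaledUnit c)⁻¹).val +
      (((op₁ c a)⁻¹ * mulUnit (scaledUnit c)⁻¹)⁻¹).val = _
    -- Conjugation by `t₁` turns `Z t₁⁻¹ + t₁ Z⁻¹` into `t₁⁻¹ Z + Z⁻¹ t₁`, which is `t₂ + t₂⁻¹`.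
    have h' := congrArg (fun y => ((op₁ c a)⁻¹).val * y * (op₁ c a).val) h
    simp only [mul_add, add_mul] at h'
    rw [← mul_assoc, Units.inv_mul_cancel_right, Units.inv_mul_cancel_left,
      ← Algebra.commutes, mul_assoc, Units.inv_mul, mul_one] at h'
    rw [mul_inv_rev, inv_inv, ← map_inv, inv_inv, Units.val_mul, Units.val_mul, mulUnit_val,
      mulUnit_val]
    exact h'
  · have h := lsmul_Z_mul_heckeUnit_inv_add (ofUnit 1 (a 0) (a 3)) refl₀_refl₀ short₀_refl₀
    rw [ofUnit_b, ofUnit_Z] at h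
    change (mulUnit (scaledUnit 1) * (op₀ a)⁻¹).val + ((mulUnit (scaledUnit 1) * (op₀ a)⁻¹)⁻¹).val = _
    rw [mul_inv_rev, inv_inv]
    exact h

variable {F : Type*} [Field F] [Algebra F R] {q : F}

theorem op_prod (hc : algebraMap F R q = c) :
    ((op c a 0 : Module.End R (ℤ →₀ R[T;T⁻¹])) * op c a 1 * op c a 2 * op c a 3) =
      algebraMap F _ q⁻¹ := by
  have hsc : (scaledUnit c)⁻¹ * scaledUnit 1 = Units.map (algebraMap R R[T;T⁻¹] : R →* _) c⁻¹ := by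
    rw [inv_mul_eq_iff_eq_mul]
    ext1
    change algebraMap R R[T;T⁻¹] 1 * LaurentPolynomial.T 1 =
      algebraMap R R[T;T⁻¹] (c : R) * LaurentPolynomial.T 1 *
        algebraMap R R[T;T⁻¹] ((c⁻¹ : Rˣ) : R)
    rw [mul_right_comm, ← map_mul, Units.mul_inv]
  have h : op c a 0 * op c a 1 * op c a 2 * op c a 3 =
      Units.map (algebraMap R (Module.End R (ℤ →₀ R[T;T⁻¹])) : R →* _) c⁻¹ := by
    change op₀ a * op₁ c a * ((op₁ c a)⁻¹ * mulUnit (scaledUnit c)⁻¹) *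
      (mulUnit (scaledUnit 1) * (op₀ a)⁻¹) = _
    have h1 : mulUnit (scaledUnit c)⁻¹ * mulUnit (scaledUnit 1) =
        Units.map (algebraMap R (Module.End R (ℤ →₀ R[T;T⁻¹])) : R →* _) c⁻¹ := by
      rw [← map_mul, hsc]
      ext1
      refine LinearMap.ext fun m => ?_
      change algebraMap R R[T;T⁻¹] ((c⁻¹ : Rˣ) : R) • m = algebraMap R (Module.End R _) _ m
      rw [Module.algebraMap_end_apply, algebraMap_smul]
    calc _ = op₀ a * (mulUnit (scaledUnit c)⁻¹ * mulUnit (scaledUnit 1)) * (op₀ a)⁻¹ := by group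
      _ = _ := by
        rw [h1, mul_inv_eq_iff_eq_mul]
        ext1
        exact (Algebra.commutes _ _).symm
  have h' := congrArg Units.val h
  simp only [Units.val_mul] at h'
  rw [h']
  refine LinearMap.ext fun m => ?_
  have hci : algebraMap F R q⁻¹ = ((c⁻¹ : Rˣ) : R) := by
    rw [← Units.mul_right_inj c, Units.mul_inv, ← hc, ← map_mul, mul_inv_cancel₀, map_one]
    rintro rfl
    exact c.ne_zero (by rw [← hc, map_zero])
  simp only [Units.coe_map, MonoidHom.coe_coe, Module.algebraMap_end_apply, ← hci]
  rw [algebraMap_smul]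

/-- The representation of `UDAHA q` on the free module on the infinite dihedral group. -/
noncomputable def rep (hc : algebraMap F R q = c) :
    UDAHA q →ₐ[F] Module.End R (ℤ →₀ R[T;T⁻¹]) :=
  lift (A := Module.End R (ℤ →₀ R[T;T⁻¹])) (op c a)
    (fun i x => by rw [op_add_inv, Algebra.commutes (R := R)]) (op_prod c a hc)

variable {c} (hc : algebraMap F R q = c)

theorem map_rep_t (i : Fin 4) :
    Units.map (rep c a hc : UDAHA q →* Module.End R (ℤ →₀ R[T;T⁻¹])) (t q i) = op c a i :=
  map_lift_t _ _ _ i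

theorem map_rep_X :
    Units.map (rep c a hc : UDAHA q →* Module.End R (ℤ →₀ R[T;T⁻¹])) (X q) = mulUnit (scaledUnit 1) := by
  rw [X, map_mul, map_rep_t, map_rep_t]
  exact inv_mul_cancel_right _ _

theorem map_rep_Y :
    Units.map (rep c a hc : UDAHA q →* Module.End R (ℤ →₀ R[T;T⁻¹])) (Y q) = op₀ a * op₁ c a := by
  rw [Y, map_mul, map_rep_t, map_rep_t]
  rfl

theorem rep_T (i : Fin 4) : rep c a hc (T q i) = algebraMap R _ (a i) := by
  rw [← op_add_inv c a i, ← map_rep_t a hc i, T, map_add]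
  rfl

section Eval

variable [Algebra R (UDAHA q)] [IsScalarTower F R (UDAHA q)]
  {a} (ha : ∀ i, algebraMap R (UDAHA q) (a i) = T q i)

omit [IsDomain R] [Algebra F R] [IsScalarTower F R (UDAHA q)] in
theorem evalUnit_scaledUnit (u : Rˣ) :
    Units.map ((evalUnit (X q) : R[T;T⁻¹] →ₐ[R] UDAHA q) : R[T;T⁻¹] →* UDAHA q) (scaledUnit u) =
      Units.map (algebraMap R (UDAHA q) : R →* _) u * X q := by
  ext1
  change evalUnit (X q) (algebraMap R R[T;T⁻¹] (u : R) * LaurentPolynomial.T 1) =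
    algebraMap R (UDAHA q) u * X q
  rw [map_mul, AlgHom.commutes, evalUnit_T, zpow_one]

include hc in
theorem t_one_mul_t_two :
    t q 1 * t q 2 = (X q)⁻¹ * (Units.map (algebraMap R (UDAHA q) : R →* _) c)⁻¹ := by
  have hq : q ≠ 0 := by
    rintro rfl
    exact c.ne_zero (by rw [← hc, map_zero])
  have h : t q 0 * t q 1 * t q 2 * t q 3 * Units.map (algebraMap R (UDAHA q) : R →* _) c = 1 := by
    ext1
    simp only [Units.val_mul, prod_t, Units.coe_map, MonoidHom.coe_coe, ← hc]
    rw [← IsScalarTower.algebraMap_apply F R (UDAHA q), ← map_mul, inv_mul_cancel₀ hq, map_one,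
      Units.val_one]
  have hcomm (u : (UDAHA q)ˣ) : Units.map (algebraMap R (UDAHA q) : R →* _) c * u =
      u * Units.map (algebraMap R (UDAHA q) : R →* _) c := by
    ext1
    exact Algebra.commutes _ _
  rw [← mul_inv_rev, eq_inv_iff_mul_eq_one, X, hcomm, mul_assoc (t q 3), ← hcomm]
  calc _ = (t q 0)⁻¹ * (t q 0 * t q 1 * t q 2 * t q 3 *
        (Units.map (algebraMap R (UDAHA q) : R →* _) c * t q 0)) := by group
    _ = (t q 0)⁻¹ * (t q 0 * t q 1 * t q 2 * t q 3 *
        Units.map (algebraMap R (UDAHA q) : R →* _) c) * t q 0 := by group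
    _ = 1 := by rw [h]; group

include ha

omit [Algebra F R] [IsScalarTower F R (UDAHA q)] in
theorem exchanges_t_zero (f : R[T;T⁻¹]) :
    Exchanges (ofUnit 1 (a 0) (a 3)) (evalUnit (X q)) (t q 0) f := by
  have hZ : Exchanges (ofUnit 1 (a 0) (a 3)) (evalUnit (X q)) (t q 0) (scaledUnit (1 : Rˣ)) := by
    rw [← ofUnit_Z 1 (a 0) (a 3)]
    refine exchanges_Z (by rw [ofUnit_a, ha]; rfl) ?_
    have h := evalUnit_scaledUnit (q := q) (1 : Rˣ)
    rw [map_one, one_mul] at h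
    have h1 := congrArg Units.val h
    have h2 := congrArg (fun u => (u⁻¹).val) h
    simp only [← map_inv] at h2
    simp only [Units.coe_map, MonoidHom.coe_coe] at h1 h2
    rw [ofUnit_Z, ofUnit_b, ha, h1, h2, ← Units.val_mul, ← Units.val_mul, X, T]
    congr 2 <;> group
  exact scaledUnit_induction 1 Exchanges.of_algebraMap (fun _ _ => .add) (fun _ _ => .mul)
    hZ hZ.inv f

include hc in
theorem exchanges_t_one (f : R[T;T⁻¹]) :
    Exchanges (ofUnitInv c (a 1) (a 2)) (evalUnit (X q)) (t q 1) f := by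
  have hZ : Exchanges (ofUnitInv c (a 1) (a 2)) (evalUnit (X q)) (t q 1)
      ((scaledUnit c)⁻¹ : (R[T;T⁻¹])ˣ) := by
    rw [← ofUnitInv_Z c (a 1) (a 2)]
    refine exchanges_Z (by rw [ofUnitInv_a, ha]; rfl) ?_
    have h := evalUnit_scaledUnit (q := q) c
    have h12 := t_one_mul_t_two hc
    rw [← mul_inv_rev, ← h] at h12
    have h1 := congrArg Units.val h12.symm
    have h2 := congrArg (fun u => (u⁻¹).val) h12.symm
    simp only [inv_inv] at h2
    simp only [← map_inv, Units.coe_map, MonoidHom.coe_coe] at h1 h2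
    rw [ofUnitInv_Z, ofUnitInv_b, ha, inv_inv, h1, h2, ← Units.val_mul, ← Units.val_mul]
    -- Since `Z = t₁t₂`, the sum `Z t₁⁻¹ + t₁ Z⁻¹` is the conjugate of `T₂` by `t₁`, which equals
    -- `T₂` by centrality.
    have h3 : (T q 2) = (t q 1).val * T q 2 * ((t q 1)⁻¹).val := by
      rw [← T_mul_comm, Units.mul_inv_cancel_right]
    rw [h3, T, mul_add, add_mul]
    simp only [← Units.val_mul]
    congr 2
    group
  refine scaledUnit_induction c Exchanges.of_algebraMap (fun _ _ => .add) (fun _ _ => .mul)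
    ?_ hZ f
  simpa using hZ.inv

omit [Algebra F R] [IsScalarTower F R (UDAHA q)] in
theorem wordMap_op₀ (m : ℤ →₀ R[T;T⁻¹]) :
    wordMap (evalUnit (X q)) (word (t q 0 : UDAHA q) (t q 1)) ((op₀ a).val m) =
      t q 0 * wordMap (evalUnit (X q)) (word (t q 0 : UDAHA q) (t q 1)) m := by
  have ht : (t q 0 : UDAHA q) + ((t q 0)⁻¹ : (UDAHA q)ˣ) =
      algebraMap R _ (ofUnit (1 : Rˣ) (a 0) (a 3)).a := by
    rw [ofUnit_a, ha, T]
  have hw (n : ℤ) (hn : short₀ n = false) : (t q 0 : UDAHA q) *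
      word (t q 0 : UDAHA q) (t q 1) n = word (t q 0 : UDAHA q) (t q 1) (refl₀ n) :=
    mul_word₀ _ _ hn
  exact wordMap_heckeOp refl₀_refl₀ short₀_refl₀ (exchanges_t_zero ha) ht hw m

include hc in
theorem wordMap_op₁ (m : ℤ →₀ R[T;T⁻¹]) :
    wordMap (evalUnit (X q)) (word (t q 0 : UDAHA q) (t q 1)) ((op₁ c a).val m) =
      t q 1 * wordMap (evalUnit (X q)) (word (t q 0 : UDAHA q) (t q 1)) m := by
  have ht : (t q 1 : UDAHA q) + ((t q 1)⁻¹ : (UDAHA q)ˣ) =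
      algebraMap R _ (ofUnitInv c (a 1) (a 2)).a := by
    rw [ofUnitInv_a, ha, T]
  have hw (n : ℤ) (hn : short₁ n = false) : (t q 1 : UDAHA q) *
      word (t q 0 : UDAHA q) (t q 1) n = word (t q 0 : UDAHA q) (t q 1) (refl₁ n) :=
    mul_word₁ _ _ hn
  exact wordMap_heckeOp refl₁_refl₁ short₁_refl₁ (exchanges_t_one hc ha) ht hw m

/-- The word map intertwines the representation with left multiplication. -/
theorem wordMap_rep (h : UDAHA q) (m : ℤ →₀ R[T;T⁻¹]) :
    wordMap (evalUnit (X q)) (word (t q 0 : UDAHA q) (t q 1)) (rep c a hc h m) =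
      h * wordMap (evalUnit (X q)) (word (t q 0 : UDAHA q) (t q 1)) m := by
  set ψ := wordMap (R := R) (evalUnit (X q)) (word (t q 0 : UDAHA q) (t q 1)) with hψ
  -- The units whose action is intertwined form a group, so `t₀`, `t₁`, `X` and `q` suffice: `t₃ = X
  -- t₀⁻¹` and `t₂ = t₁⁻¹ X⁻¹ q⁻¹`.
  let G : Subgroup (UDAHA q)ˣ :=
    { carrier := {u | ∀ m, ψ (rep c a hc u m) = u * ψ m}
      one_mem' := by intro m; simp
      mul_mem' := by
        intro u v hu hv m
        rw [Units.val_mul, map_mul, Module.End.mul_apply, hu, hv, mul_assoc]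
      inv_mem' := by
        intro u hu m
        have h1 := hu (rep c a hc (u⁻¹ : (UDAHA q)ˣ) m)
        rw [← Module.End.mul_apply, ← map_mul, Units.mul_inv, map_one, Module.End.one_apply] at h1
        rw [h1, Units.inv_mul_cancel_left] }
  have h0 : t q 0 ∈ G := by
    intro m
    have := congrArg Units.val (map_rep_t a hc 0)
    simp only [Units.coe_map, MonoidHom.coe_coe] at this
    rw [this]
    exact wordMap_op₀ ha m
  have h1 : t q 1 ∈ G := by
    intro m
    have := congrArg Units.val (map_rep_t a hc 1)
    simp only [Units.coe_map, MonoidHom.coe_coe] at this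
    rw [this]
    exact wordMap_op₁ hc ha m
  have hX : X q ∈ G := by
    intro m
    have := congrArg Units.val (map_rep_X a hc)
    simp only [Units.coe_map, MonoidHom.coe_coe] at this
    have h2 := congrArg Units.val (evalUnit_scaledUnit (q := q) (1 : Rˣ))
    simp only [Units.coe_map, MonoidHom.coe_coe, map_one, one_mul] at h2
    rw [this, mulUnit_val, Algebra.lsmul_coe, hψ, wordMap_smul, h2]
  have hcG : Units.map (algebraMap R (UDAHA q) : R →* _) c ∈ G := by
    intro m
    simp only [Units.coe_map, MonoidHom.coe_coe, ← hc]
    rw [← IsScalarTower.algebraMap_apply F R (UDAHA q), AlgHom.commutes,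
      Module.algebraMap_end_apply, IsScalarTower.algebraMap_apply F R (UDAHA q),
      ← Algebra.smul_def, ← map_smul, algebraMap_smul]
  have h3 : t q 3 ∈ G := by
    have : t q 3 = X q * (t q 0)⁻¹ := by rw [X, mul_inv_cancel_right]
    rw [this]
    exact G.mul_mem hX (G.inv_mem h0)
  have h2 : t q 2 ∈ G := by
    have := t_one_mul_t_two hc
    rw [← eq_inv_mul_iff_mul_eq] at this
    rw [this]
    exact G.mul_mem (G.inv_mem h1) (G.mul_mem (G.inv_mem hX) (G.inv_mem hcG))
  have ht : ∀ i, t q i ∈ G := by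
    intro i
    fin_cases i
    · exact h0
    · exact h1
    · exact h2
    · exact h3
  induction h using UDAHA.induction generalizing m with
  | halg r =>
    rw [AlgHom.commutes, Module.algebraMap_end_apply, IsScalarTower.algebraMap_apply F R (UDAHA q),
      ← Algebra.smul_def, ← map_smul, algebraMap_smul]
  | ht i => exact ht i m
  | ht' i => exact G.inv_mem (ht i) m
  | hadd x y hx hy => rw [map_add, LinearMap.add_apply, map_add, hx, hy, add_mul]
  | hmul x y hx hy => rw [map_mul, Module.End.mul_apply, hx, hy, mul_assoc]

/-- `rep` is only an `F`-algebra map; this is what makes evaluation at `e₀` linear over `R`. -/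
theorem rep_algebraMap (hgen : Algebra.adjoin F (Set.range a) = ⊤) (r : R) :
    rep c a hc (algebraMap R (UDAHA q) r) = algebraMap R _ r := by
  have hr : r ∈ Algebra.adjoin F (Set.range a) := hgen ▸ Algebra.mem_top
  induction hr using Algebra.adjoin_induction with
  | mem x hx =>
    obtain ⟨i, rfl⟩ := hx
    rw [ha, rep_T]
  | algebraMap x =>
    rw [← IsScalarTower.algebraMap_apply F R (UDAHA q), AlgHom.commutes]
    refine LinearMap.ext fun m => ?_
    rw [Module.algebraMap_end_apply, Module.algebraMap_end_apply, algebraMap_smul]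
  | add x y _ _ hx hy => simp only [map_add, hx, hy]
  | mul x y _ _ hx hy => simp only [map_mul, hx, hy]

/-- Evaluation of the representation at the base vector. -/
noncomputable def repEval (hgen : Algebra.adjoin F (Set.range a) = ⊤) :
    UDAHA q →ₗ[R] (ℤ →₀ R[T;T⁻¹]) where
  toFun h := rep c a hc h (Finsupp.single 0 1)
  map_add' x y := by simp
  map_smul' r x := by
    rw [Algebra.smul_def, map_mul, rep_algebraMap hc ha hgen, Module.End.mul_apply,
      Module.algebraMap_end_apply, RingHom.id_apply]

/-- The word of `0` is empty, so `wordMap` sends `h e₀` to `h * 1`. This is the half of the argument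
that makes the PBW elements span. -/
theorem repEval_injective (hgen : Algebra.adjoin F (Set.range a) = ⊤) :
    Function.Injective (repEval hc ha hgen) := by
  refine Function.LeftInverse.injective
    (g := wordMap (evalUnit (X q)) (word (t q 0 : UDAHA q) (t q 1))) fun h => ?_
  change wordMap _ _ (rep c a hc h (Finsupp.single 0 1)) = h
  rw [wordMap_rep hc ha, wordMap_single, map_one, one_mul]
  exact mul_one h

end Eval

end Rep

end UDAHA

/-! ### Filtrations and leading terms -/

/-- A family of linear maps that is triangular with invertible diagonal with respect to an
exhaustive filtration by submodules assembles to a bijection. -/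
theorem Finsupp.lsum_bijective_of_filtration {R V M : Type*} [CommRing R] [AddCommGroup V]
    [Module R V] [AddCommGroup M] [Module R M] (fil : ℕ → Submodule R M) (hmono : Monotone fil)
    (h0 : fil 0 = ⊥) (hex : ∀ m, ∃ n, m ∈ fil n) (D : ℕ → V →ₗ[R] M)
    (hmem : ∀ n v, D n v ∈ fil (n + 1)) (hinj : ∀ n v, D n v ∈ fil n → v = 0)
    (hsurj : ∀ n, ∀ m ∈ fil (n + 1), ∃ v, m - D n v ∈ fil n) :
    Function.Bijective (Finsupp.lsum R D : (ℕ →₀ V) →ₗ[R] M) := by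
  constructor
  · rw [injective_iff_map_eq_zero]
    intro x hx
    by_contra hne
    have hs : x.support.Nonempty := Finsupp.support_nonempty_iff.mpr hne
    set N := x.support.max' hs with hN
    have hNs : N ∈ x.support := x.support.max'_mem hs
    rw [Finsupp.lsum_apply, Finsupp.sum, ← Finset.add_sum_erase _ _ hNs] at hx
    refine Finsupp.mem_support_iff.mp hNs (hinj N _ ?_)
    -- All terms below the top index `N` lie in `fil N`, so the top term does too.
    rw [eq_neg_of_add_eq_zero_left hx]
    refine Submodule.neg_mem _ (Submodule.sum_mem _ fun n hn => ?_)
    rw [Finset.mem_erase] at hn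
    exact hmono (lt_of_le_of_ne (x.support.le_max' n hn.2) hn.1 : n < N) (hmem n _)
  · have key : ∀ n, fil n ≤ LinearMap.range (Finsupp.lsum R D : (ℕ →₀ V) →ₗ[R] M) := by
      intro n
      induction n with
      | zero => rw [h0]; exact bot_le
      | succ n ih =>
        intro m hm
        obtain ⟨v, hv⟩ := hsurj n m hm
        have h1 : D n v ∈ LinearMap.range (Finsupp.lsum R D : (ℕ →₀ V) →ₗ[R] M) :=
          ⟨Finsupp.single n v, by simp⟩
        simpa using Submodule.add_mem _ (ih hv) h1
    intro m
    obtain ⟨n, hn⟩ := hex m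
    exact key n hn

namespace Demazure

variable {R L : Type*} [CommRing R] [CommRing L] [Algebra R L] (d : Demazure R L)

/-- The involution of an exchange datum as a linear equivalence. -/
def sEquiv : L ≃ₗ[R] L := LinearEquiv.ofInvolutive d.s.toLinearMap d.s_s

theorem sEquiv_apply (f : L) : d.sEquiv f = d.s f := rfl

variable {ι : Type*} {π : ι → ι} {hi : ι → Bool}
  (hπ : ∀ n, π (π n) = n) (hhi : ∀ n, hi (π n) = !hi n)
include hπ hhi

theorem heckeOp_apply (m : ι →₀ L) (k : ι) :
    d.heckeOp π hi m k = d.der (m k) +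
      if hi k then d.a • d.s (m k) + d.s (m (π k)) else -d.s (m (π k)) := by
  induction m using Finsupp.induction_linear with
  | zero => simp
  | add x y hx hy =>
    simp only [map_add, Finsupp.add_apply, hx, hy]
    split_ifs
    · rw [smul_add]; abel
    · abel
  | single n f =>
    have hne : π n ≠ n := fun h => by
      have := hhi n
      rw [h] at this
      cases h' : hi n <;> simp [h'] at this
    have hne' : n ≠ π n := hne.symm
    classical
    by_cases hkn : k = n
    · subst hkn
      cases h : hi k
      · rw [heckeOp_lo d π h]
        simp [hne, hne']
      · rw [heckeOp_hi d π h]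
        simp [hne, hne']
    · by_cases hkn' : k = π n
      · subst hkn'
        have := hhi n
        cases h : hi n
        · rw [heckeOp_lo d π h]
          simp [hne, hπ, this, h]
        · rw [heckeOp_hi d π h]
          simp [hne, hπ, this, h]
      · have h1 : n ≠ k := fun h => hkn h.symm
        have h2 : π n ≠ k := fun h => hkn' h.symm
        have h3 : n ≠ π k := fun h => hkn' (by rw [h, hπ])
        cases h : hi n
        · rw [heckeOp_lo d π h]
          simp [hkn, hkn', h3.symm]
        · rw [heckeOp_hi d π h]
          simp [hkn, hkn', h3.symm]

theorem heckeUnit_apply (m : ι →₀ L) (k : ι) :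
    (d.heckeUnit hπ hhi).val m k = d.der (m k) +
      if hi k then d.a • d.s (m k) + d.s (m (π k)) else -d.s (m (π k)) :=
  heckeOp_apply d hπ hhi m k

theorem heckeUnit_inv_apply (m : ι →₀ L) (k : ι) :
    ((d.heckeUnit hπ hhi)⁻¹).val m k = d.a • m k - (d.der (m k) +
      if hi k then d.a • d.s (m k) + d.s (m (π k)) else -d.s (m (π k))) := by
  rw [← heckeOp_apply d hπ hhi]
  change (algebraMap R (Module.End R (ι →₀ L)) d.a - d.heckeOp π hi) m k = _
  rw [LinearMap.sub_apply, Module.algebraMap_end_apply, Finsupp.sub_apply, Finsupp.smul_apply]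

end Demazure

namespace DihedralChain

/-- The length of the minimal representative of the coset of `n` modulo right multiplication by
`s₀`. -/
def level (n : ℤ) : ℕ := if 0 ≤ n then n.toNat else (-1 - n).toNat

variable {R L : Type*} [CommRing R] [CommRing L] [Algebra R L]

variable (R L) in
/-- The elements supported on cosets of length less than `n`. -/
def fil (n : ℕ) : Submodule R (ℤ →₀ L) where
  carrier := {m | ∀ k, n ≤ level k → m k = 0}
  zero_mem' := by intro k _; rfl
  add_mem' := by
    intro x y hx hy k hk
    rw [Finsupp.add_apply, hx k hk, hy k hk, add_zero]
  smul_mem' := by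
    intro r x hx k hk
    rw [Finsupp.smul_apply, hx k hk, smul_zero]

theorem fil_mono : Monotone (fil R L) := fun _ _ h _ hm k hk => hm k (h.trans hk)

theorem fil_zero : fil R L 0 = ⊥ := by
  rw [eq_bot_iff]
  intro m hm
  rw [Submodule.mem_bot]
  ext k
  exact hm k (Nat.zero_le _)

theorem exists_mem_fil (m : ℤ →₀ L) : ∃ n, m ∈ fil R L n := by
  refine ⟨m.support.sup level + 1, fun k hk => ?_⟩
  by_contra h
  have := Finset.le_sup (f := level) (Finsupp.mem_support_iff.mpr h)
  omega

theorem mem_fil_of_mem_succ {n : ℕ} {m : ℤ →₀ L} (hm : m ∈ fil R L (n + 1)) (h1 : m n = 0)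
    (h2 : m (-1 - n) = 0) : m ∈ fil R L n := by
  intro k hk
  by_cases h : n + 1 ≤ level k
  · exact hm k h
  · have : k = n ∨ k = -1 - n := by
      simp only [level] at hk h
      split_ifs at hk h <;> omega
    rcases this with rfl | rfl
    · exact h1
    · exact h2

theorem level_natCast (n : ℕ) : level n = n := by simp [level]

theorem level_neg (n : ℕ) : level (-1 - n) = n := by simp only [level]; split_ifs <;> omega

theorem level_refl₀_le {n : ℕ} (hn : n % 2 = 0) {k : ℤ} (hk : n < level k) :
    n < level (refl₀ k) := by
  simp only [level, refl₀] at *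
  split_ifs at * <;> omega

theorem level_refl₁_le {n : ℕ} (hn : n % 2 = 1) {k : ℤ} (hk : n < level k) :
    n < level (refl₁ k) := by
  simp only [level, refl₁] at *
  split_ifs at * <;> omega

/-- The operator `φ` maps the bottom piece of the filtration to the `n`-th piece, and is given
there by an invertible map on leading terms. -/
def Leads (n : ℕ) (φ : Module.End R (ℤ →₀ L)) : Prop :=
  ∃ σ : L ≃ₗ[R] L, ∀ m ∈ fil R L 1,
    φ m ∈ fil R L (n + 1) ∧ φ m n = σ (m 0) ∧ φ m (-1 - n) = σ (m (-1))

/-- The operator `φ` identifies the bottom piece of the filtration with the `n`-th graded piece. -/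
def Splits (n : ℕ) (φ : Module.End R (ℤ →₀ L)) : Prop :=
  (∀ m ∈ fil R L 1, φ m ∈ fil R L (n + 1)) ∧ (∀ m ∈ fil R L 1, φ m ∈ fil R L n → m = 0) ∧
    ∀ m' ∈ fil R L (n + 1), ∃ m ∈ fil R L 1, m' - φ m ∈ fil R L n

theorem Leads.one : Leads 0 (1 : Module.End R (ℤ →₀ L)) :=
  ⟨LinearEquiv.refl R L, fun _ hm => ⟨hm, rfl, rfl⟩⟩

theorem eq_zero_of_mem_fil_one {m : ℤ →₀ L} (hm : m ∈ fil R L 1) (h0 : m 0 = 0)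
    (h1 : m (-1) = 0) : m = 0 := by
  have : m ∈ fil R L 0 := mem_fil_of_mem_succ hm (by simpa using h0) (by simpa using h1)
  rwa [fil_zero, Submodule.mem_bot] at this

theorem single_add_single_mem_fil_one (f g : L) :
    Finsupp.single 0 f + Finsupp.single (-1) g ∈ fil R L 1 := by
  intro k hk
  have h0 : (0 : ℤ) ≠ k := by rintro rfl; simp [level] at hk
  have h1 : (-1 : ℤ) ≠ k := by rintro rfl; simp [level] at hk
  simp [h0.symm, h1.symm]

theorem Leads.splits {n : ℕ} {φ : Module.End R (ℤ →₀ L)} (h : Leads n φ) : Splits n φ := by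
  obtain ⟨σ, hσ⟩ := h
  refine ⟨fun m hm => (hσ m hm).1, fun m hm hφ => ?_, fun m' hm' => ?_⟩
  · obtain ⟨-, h1, h2⟩ := hσ m hm
    rw [hφ _ (level_natCast n).ge] at h1
    rw [hφ _ (level_neg n).ge] at h2
    exact eq_zero_of_mem_fil_one hm (σ.map_eq_zero_iff.mp h1.symm) (σ.map_eq_zero_iff.mp h2.symm)
  · have hm := single_add_single_mem_fil_one (R := R) (σ.symm (m' n)) (σ.symm (m' (-1 - n)))
    obtain ⟨h0, h1, h2⟩ := hσ _ hm
    refine ⟨_, hm, mem_fil_of_mem_succ (Submodule.sub_mem _ hm' h0) ?_ ?_⟩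
    · rw [Finsupp.sub_apply, h1]; simp
    · rw [Finsupp.sub_apply, h2]; simp

section Step

variable (d : Demazure R L) {π : ℤ → ℤ} {hi : ℤ → Bool}
  (hπ : ∀ n, π (π n) = n) (hhi : ∀ n, hi (π n) = !hi n)

/-- At the two new positions the old vector vanishes, so only `s` of the coordinate at `π k`
survives. For the inverse `a - t` the same holds with a sign, since the term in `a` vanishes there
too. `hlev` keeps higher levels zero. -/
theorem Leads.heckeUnit_mul {n : ℕ} {φ : Module.End R (ℤ →₀ L)} (h : Leads n φ)
    (h1 : π (n + 1 : ℕ) = n) (h2 : π (-1 - (n + 1 : ℕ)) = -1 - n) (h3 : hi (n + 1 : ℕ) = true)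
    (h4 : hi (-1 - (n + 1 : ℕ)) = true) (hlev : ∀ k, n + 1 < level k → n + 1 < level (π k)) :
    Leads (n + 1) ((d.heckeUnit hπ hhi).val * φ) ∧
      Leads (n + 1) (((d.heckeUnit hπ hhi)⁻¹).val * φ) := by
  obtain ⟨σ, hσ⟩ := h
  refine ⟨⟨σ.trans d.sEquiv, fun m hm => ?_⟩,
    ⟨σ.trans (d.sEquiv.trans (LinearEquiv.neg R)), fun m hm => ?_⟩⟩ <;>
  · obtain ⟨e0, e1, e2⟩ := hσ m hm
    have e3 := e0 (n + 1 : ℕ) (level_natCast _).ge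
    have e4 := e0 (-1 - (n + 1 : ℕ)) (level_neg _).ge
    refine ⟨fun k hk => ?_, ?_, ?_⟩
    · have e5 := e0 k (by omega)
      have e6 := e0 (π k) (by have := hlev k (by omega); omega)
      simp [Demazure.heckeUnit_apply, Demazure.heckeUnit_inv_apply, e5, e6]
    · rw [Module.End.mul_apply]
      simp only [Demazure.heckeUnit_apply, Demazure.heckeUnit_inv_apply, e3, h1, h3, e1]
      simp [Demazure.sEquiv_apply]
    · rw [Module.End.mul_apply]
      simp only [Demazure.heckeUnit_apply, Demazure.heckeUnit_inv_apply, e4, h2, h4, e2]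
      simp [Demazure.sEquiv_apply]

end Step

end DihedralChain

/-! ### Powers of `Y` and the PBW basis over the central polynomial ring -/

namespace UDAHA

open LaurentPolynomial DihedralChain Demazure

variable {R : Type*} [CommRing R] [IsDomain R] (c : Rˣ) (a : Fin 4 → R)

theorem leads_op₁_mul {n : ℕ} (hn : n % 2 = 0) {φ : Module.End R (ℤ →₀ R[T;T⁻¹])}
    (h : Leads n φ) :
    Leads (n + 1) ((op₁ c a).val * φ) ∧ Leads (n + 1) (((op₁ c a)⁻¹).val * φ) :=
  h.heckeUnit_mul _ refl₁_refl₁ short₁_refl₁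
    (by simp only [refl₁]; split_ifs <;> omega) (by simp only [refl₁]; split_ifs <;> omega)
    (by simp only [short₁]; split_ifs <;> first | omega | (rw [decide_eq_true_iff]; omega))
    (by simp only [short₁]; split_ifs <;> first | omega | (rw [decide_eq_true_iff]; omega))
    (fun _ => level_refl₁_le (by omega))

theorem leads_op₀_mul {n : ℕ} (hn : n % 2 = 1) {φ : Module.End R (ℤ →₀ R[T;T⁻¹])}
    (h : Leads n φ) :
    Leads (n + 1) ((op₀ a).val * φ) ∧ Leads (n + 1) (((op₀ a)⁻¹).val * φ) :=
  h.heckeUnit_mul _ refl₀_refl₀ short₀_refl₀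
    (by simp only [refl₀]; split_ifs <;> omega) (by simp only [refl₀]; split_ifs <;> omega)
    (by simp only [short₀]; split_ifs <;> first | omega | (rw [decide_eq_true_iff]; omega))
    (by simp only [short₀]; split_ifs <;> first | omega | (rw [decide_eq_true_iff]; omega))
    (fun _ => level_refl₀_le (by omega))

theorem leads_Y_pow (i : ℕ) : Leads (2 * i) ((op₀ a * op₁ c a) ^ i).val := by
  induction i with
  | zero => exact Leads.one
  | succ i ih =>
    have h := (leads_op₀_mul a (by omega) (leads_op₁_mul c a (by omega) ih).1).1
    rw [pow_succ', Units.val_mul, Units.val_mul, mul_assoc]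
    exact h

/-- The factor `t₀` cancels the last letter of `Y^{-(i+1)}`, leaving an alternating product of `2i +
1` inverses that ends with `t₁⁻¹`, so every letter raises the level. -/
theorem leads_Y_inv_pow (i : ℕ) :
    Leads (2 * i + 1) (((op₀ a * op₁ c a)⁻¹ ^ (i + 1)).val * (op₀ a).val) := by
  induction i with
  | zero =>
    have h := (leads_op₁_mul c a (by omega) Leads.one).2
    rw [← Units.val_mul]
    simpa using h
  | succ i ih =>
    have h := (leads_op₁_mul c a (by omega) (leads_op₀_mul a (by omega) ih).2).2
    rw [pow_succ', Units.val_mul, mul_inv_rev, Units.val_mul, mul_assoc, mul_assoc, ← mul_inv_rev]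
    exact h

theorem op₀_mem_fil_one {m : ℤ →₀ R[T;T⁻¹]} (hm : m ∈ fil R R[T;T⁻¹] 1) :
    (op₀ a).val m ∈ fil R R[T;T⁻¹] 1 ∧ ((op₀ a)⁻¹).val m ∈ fil R R[T;T⁻¹] 1 := by
  constructor <;>
  · intro k hk
    have e5 := hm k hk
    have e6 := hm (refl₀ k) (level_refl₀_le (n := 0) rfl hk)
    simp [op₀, Demazure.heckeUnit_apply, Demazure.heckeUnit_inv_apply, e5, e6]

variable {a} in
-- The bottom piece is the coset `{1, s₀}`, which `t₀` maps bijectively to itself. As `t₀` mixes its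
-- two coordinates, `Leads` need not pass to `φ`, but `Splits` does.
theorem splits_of_splits_mul_op₀ {n : ℕ} {φ : Module.End R (ℤ →₀ R[T;T⁻¹])}
    (h : Splits n (φ * (op₀ a).val)) : Splits n φ := by
  obtain ⟨h1, h2, h3⟩ := h
  have e (m : ℤ →₀ R[T;T⁻¹]) : (φ * (op₀ a).val) (((op₀ a)⁻¹).val m) = φ m := by
    rw [← Module.End.mul_apply, mul_assoc, Units.mul_inv, mul_one]
  refine ⟨fun m hm => ?_, fun m hm hφ => ?_, fun m' hm' => ?_⟩
  · rw [← e]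
    exact h1 _ (op₀_mem_fil_one a hm).2
  · rw [← e] at hφ
    have h4 := h2 _ (op₀_mem_fil_one a hm).2 hφ
    have h5 := congrArg (op₀ a).val h4
    rwa [← Module.End.mul_apply, Units.mul_inv, Module.End.one_apply, map_zero] at h5
  · obtain ⟨m, hm, hm2⟩ := h3 m' hm'
    exact ⟨(op₀ a).val m, (op₀_mem_fil_one a hm).1, hm2⟩

/-- `Equiv.intEquivNat` sends `i ≥ 0` to `2i` and `-(i + 1)` to `2i + 1`, exactly the levels reached
by these powers of `Y`; hence each level occurs once. -/
theorem splits_Y_zpow (i : ℤ) :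
    Splits (Equiv.intEquivNat i) ((op₀ a * op₁ c a) ^ i).val := by
  rcases i with i | i
  · exact (leads_Y_pow c a i).splits
  · have h := splits_of_splits_mul_op₀ (leads_Y_inv_pow c a i).splits
    rw [zpow_negSucc, ← inv_pow]
    exact h

/-- The inclusion of the bottom piece of the filtration. -/
noncomputable def bottom : (Fin 2 →₀ R[T;T⁻¹]) →ₗ[R] (ℤ →₀ R[T;T⁻¹]) :=
  Finsupp.lmapDomain _ R fun k : Fin 2 => -((k : ℕ) : ℤ)

omit [IsDomain R] in
theorem bottom_single (k : Fin 2) (f : R[T;T⁻¹]) :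
    bottom (Finsupp.single k f) = Finsupp.single (-((k : ℕ) : ℤ)) f := by
  simp [bottom]

omit [IsDomain R] in
theorem bottom_injective : Function.Injective (bottom : (Fin 2 →₀ R[T;T⁻¹]) →ₗ[R] _) :=
  Finsupp.mapDomain_injective fun k l h => by
    ext
    exact_mod_cast neg_injective h

omit [IsDomain R] in
theorem bottom_mem (v : Fin 2 →₀ R[T;T⁻¹]) : bottom v ∈ fil R R[T;T⁻¹] 1 := by
  induction v using Finsupp.induction_linear with
  | zero => simp
  | add x y hx hy => rw [map_add]; exact Submodule.add_mem _ hx hy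
  | single k f =>
    rw [bottom_single]
    fin_cases k
    · simpa using single_add_single_mem_fil_one (R := R) f 0
    · simpa using single_add_single_mem_fil_one (R := R) 0 f

omit [IsDomain R] in
theorem exists_bottom_eq {m : ℤ →₀ R[T;T⁻¹]} (hm : m ∈ fil R R[T;T⁻¹] 1) :
    ∃ v, bottom v = m := by
  refine ⟨Finsupp.single 0 (m 0) + Finsupp.single 1 (m (-1)), ?_⟩
  rw [map_add, bottom_single, bottom_single, ← sub_eq_zero]
  refine eq_zero_of_mem_fil_one (R := R) (Submodule.sub_mem _ ?_ hm) ?_ ?_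
  · simpa using single_add_single_mem_fil_one (R := R) (m 0) (m (-1))
  · simp
  · simp

theorem chain_bijective :
    Function.Bijective (Finsupp.lsum R fun n : ℕ =>
      ((op₀ a * op₁ c a) ^ (Equiv.intEquivNat.symm n)).val ∘ₗ bottom :
        (ℕ →₀ (Fin 2 →₀ R[T;T⁻¹])) →ₗ[R] (ℤ →₀ R[T;T⁻¹])) := by
  have h (n : ℕ) : Splits n ((op₀ a * op₁ c a) ^ (Equiv.intEquivNat.symm n)).val := by
    have := splits_Y_zpow c a (Equiv.intEquivNat.symm n)
    rwa [Equiv.apply_symm_apply] at this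
  refine Finsupp.lsum_bijective_of_filtration (fil R R[T;T⁻¹]) fil_mono fil_zero exists_mem_fil _
    (fun n v => (h n).1 _ (bottom_mem v)) (fun n v hv => ?_) fun n m hm => ?_
  · exact bottom_injective (((h n).2.1 _ (bottom_mem v) hv).trans (map_zero _).symm)
  · obtain ⟨m', hm', h'⟩ := (h n).2.2 m hm
    obtain ⟨v, rfl⟩ := exists_bottom_eq hm'
    exact ⟨v, h'⟩

/-- The index equivalence between PBW exponents and the levels of the chain. -/
def pbwIndex : (Σ _ : ℕ, Σ _ : Fin 2, ℤ) ≃ ℤ × ℤ × Fin 2 where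
  toFun x := (Equiv.intEquivNat.symm x.1, x.2.2, x.2.1)
  invFun x := ⟨Equiv.intEquivNat x.1, x.2.2, x.2.1⟩
  left_inv x := by simp
  right_inv x := by simp

/-- The basis of the chain module formed by the vectors `Yⁱ Xʲ t₀ᵏ e₀`. -/
noncomputable def chainBasis : Module.Basis (ℤ × ℤ × Fin 2) R (ℤ →₀ R[T;T⁻¹]) :=
  ((Finsupp.basis fun _ : ℕ => Finsupp.basis fun _ : Fin 2 => AddMonoidAlgebra.basis ℤ R).map
    (LinearEquiv.ofBijective _ (chain_bijective c a))).reindex pbwIndex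

theorem chainBasis_apply (i j : ℤ) (k : Fin 2) :
    chainBasis c a (i, j, k) = ((op₀ a * op₁ c a) ^ i).val
      (Finsupp.single (-((k : ℕ) : ℤ)) (LaurentPolynomial.T j)) := by
  simp [chainBasis, pbwIndex, bottom_single, LaurentPolynomial.T, -single_eq_C_mul_T]

variable {F : Type*} [Field F] [Algebra F R] {q : F} {c a} (hc : algebraMap F R q = c)
  [Algebra R (UDAHA q)] [IsScalarTower F R (UDAHA q)]
  (ha : ∀ i, algebraMap R (UDAHA q) (a i) = T q i)
  (hgen : Algebra.adjoin F (Set.range a) = ⊤)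

theorem op₀_single_zero :
    (op₀ a).val (Finsupp.single 0 1) = Finsupp.single (-1) (1 : R[T;T⁻¹]) := by
  refine ((ofUnit 1 (a 0) (a 3)).heckeOp_lo refl₀ (hi := short₀) (n := 0) (by simp [short₀])
    1).trans ?_
  simp [refl₀, der_one]

theorem repEval_pbw (i j : ℤ) (k : Fin 2) :
    repEval hc ha hgen (((Y q ^ i : (UDAHA q)ˣ) : UDAHA q) * ((X q ^ j : (UDAHA q)ˣ) : UDAHA q) *
      (t q 0 : UDAHA q) ^ (k : ℕ)) = chainBasis c a (i, j, k) := by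
  have hY : rep c a hc ((Y q ^ i : (UDAHA q)ˣ) : UDAHA q) = ((op₀ a * op₁ c a) ^ i).val := by
    rw [← map_rep_Y a hc, ← map_zpow]; rfl
  have hX : rep c a hc ((X q ^ j : (UDAHA q)ˣ) : UDAHA q) =
      (mulUnit (scaledUnit 1 ^ j)).val := by
    rw [map_zpow, ← map_rep_X a hc, ← map_zpow]; rfl
  have ht : rep c a hc (t q 0 : UDAHA q) = (op₀ a).val := congrArg Units.val (map_rep_t a hc 0)
  have hs : ((scaledUnit (1 : Rˣ) ^ j : (R[T;T⁻¹])ˣ) : R[T;T⁻¹]) = LaurentPolynomial.T j := by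
    have h2 : evalUnit (scaledUnit (1 : Rˣ)) = AlgHom.id R R[T;T⁻¹] := by
      refine AlgHom.ext fun f => ?_
      refine induction_mul (P := fun f => evalUnit (scaledUnit (1 : Rˣ)) f = AlgHom.id R _ f)
        (fun r => ?_) (fun f g hf hg => ?_) (fun f g hf hg => ?_) ?_ ?_ f
      · simp only [AlgHom.commutes]
      · simp only [map_add, hf, hg]
      · simp only [map_mul, hf, hg]
      · simp [scaledUnit]
      · simp [scaledUnit]
    have h3 := evalUnit_T (R := R) (scaledUnit (1 : Rˣ)) j
    rw [h2] at h3
    exact h3.symm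
  change rep c a hc _ (Finsupp.single 0 1) = _
  rw [chainBasis_apply, map_mul, map_mul, map_pow, hY, hX, ht, Module.End.mul_apply,
    Module.End.mul_apply, mulUnit_val, hs]
  fin_cases k
  · simp
  · simp [op₀_single_zero]

include hc ha hgen in
/-- The PBW basis of `UDAHA q` over the polynomial ring generated by the central elements. -/
theorem exists_pbw_basis :
    ∃ b : Module.Basis (ℤ × ℤ × Fin 2) R (UDAHA q), ∀ i j k, b (i, j, k) =
      ((Y q ^ i : (UDAHA q)ˣ) : UDAHA q) * ((X q ^ j : (UDAHA q)ˣ) : UDAHA q) *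
        (t q 0 : UDAHA q) ^ (k : ℕ) := by
  -- The image contains the basis vectors `Yⁱ Xʲ t₀ᵏ e₀`.
  have hsurj : Function.Surjective (repEval hc ha hgen) := by
    rw [← LinearMap.range_eq_top, eq_top_iff, ← (chainBasis c a).span_eq, Submodule.span_le]
    rintro _ ⟨⟨i, j, k⟩, rfl⟩
    exact ⟨_, repEval_pbw hc ha hgen i j k⟩
  let E := LinearEquiv.ofBijective (repEval hc ha hgen) ⟨repEval_injective hc ha hgen, hsurj⟩
  refine ⟨(chainBasis c a).map E.symm, fun i j k => ?_⟩
  rw [Module.Basis.map_apply, LinearEquiv.symm_apply_eq]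
  exact (repEval_pbw hc ha hgen i j k).symm

end UDAHA

/-! ### The basis `Tᵏ (T + T⁻¹)^ℓ` of the Laurent polynomials -/

namespace LaurentPolynomial

section Window

variable {F : Type*} [Field F]

variable (F) in
/-- The Laurent polynomials all of whose exponents lie between `a` and `b`. -/
def window (a b : ℤ) : Submodule F F[T;T⁻¹] where
  carrier := {f | ∀ d, d < a ∨ b < d → f.coeff d = 0}
  zero_mem' := by intro d _; rfl
  add_mem' := by
    intro x y hx hy d hd
    rw [AddMonoidAlgebra.coeff_add, Finsupp.add_apply, hx d hd, hy d hd, add_zero]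
  smul_mem' := by
    intro r x hx d hd
    rw [AddMonoidAlgebra.coeff_smul, Finsupp.smul_apply, hx d hd, smul_zero]

theorem window_mono {a b a' b' : ℤ} (ha : a' ≤ a) (hb : b ≤ b') : window F a b ≤ window F a' b' :=
  fun _ hf d hd => hf d (by omega)

theorem T_mem_window {a b d : ℤ} (ha : a ≤ d) (hb : d ≤ b) : (T d : F[T;T⁻¹]) ∈ window F a b := by
  intro e he
  rw [T_apply, if_neg (by omega)]

theorem T_mul_mem_window {a b : ℤ} (d : ℤ) {f : F[T;T⁻¹]} (hf : f ∈ window F a b) :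
    T d * f ∈ window F (a + d) (b + d) := by
  intro e he
  have h : (T d * f).coeff e = f.coeff (e - d) := by
    rw [T, AddMonoidAlgebra.coeff_single_mul_eq_mul_coeff (m₂ := e - d), one_mul]
    intro m _
    omega
  rw [h]
  exact hf _ (by omega)

variable (F) in
/-- The Laurent polynomial `T + T⁻¹`. -/
noncomputable def trace : F[T;T⁻¹] := T 1 + T (-1)

theorem trace_mul_mem_window {a b : ℤ} {f : F[T;T⁻¹]} (hf : f ∈ window F a b) :
    trace F * f ∈ window F (a - 1) (b + 1) := by
  rw [trace, add_mul]
  exact Submodule.add_mem _ (window_mono (by omega) (by omega) (T_mul_mem_window 1 hf))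
    (window_mono (by omega) (by omega) (T_mul_mem_window (-1) hf))

theorem trace_pow_sub_T_neg (l : ℕ) :
    trace F ^ l - T (-(l : ℤ)) ∈ window F (-l + 1) l := by
  induction l with
  | zero => simp
  | succ l ih =>
    have h : trace F ^ (l + 1) - T (-((l + 1 : ℕ) : ℤ)) =
        trace F * (trace F ^ l - T (-(l : ℤ))) + T (1 - l) := by
      rw [mul_sub, trace, add_mul (T 1) (T (-1)) (T _), ← T_add, ← T_add, pow_succ',
        show (1 : ℤ) + -l = 1 - l by ring, show (-1 : ℤ) + -l = -((l + 1 : ℕ) : ℤ) by push_cast; ring]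
      abel
    rw [h]
    exact Submodule.add_mem _
      (window_mono (by push_cast; omega) (by push_cast; omega) (trace_mul_mem_window ih))
      (T_mem_window (by push_cast; omega) (by push_cast; omega))

theorem trace_pow_sub_T (l : ℕ) :
    trace F ^ l - T (l : ℤ) ∈ window F (-l) (l - 1) := by
  induction l with
  | zero => simp
  | succ l ih =>
    have h : trace F ^ (l + 1) - T ((l + 1 : ℕ) : ℤ) =
        trace F * (trace F ^ l - T (l : ℤ)) + T (l - 1) := by
      rw [mul_sub, trace, add_mul (T 1) (T (-1)) (T _), ← T_add, ← T_add, pow_succ',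
        show (-1 : ℤ) + l = l - 1 by ring, show (1 : ℤ) + l = ((l + 1 : ℕ) : ℤ) by push_cast; ring]
      abel
    rw [h]
    exact Submodule.add_mem _
      (window_mono (by push_cast; omega) (by push_cast; omega) (trace_mul_mem_window ih))
      (T_mem_window (by push_cast; omega) (by push_cast; omega))

/-- The exponent of the leading term of `T ^ (n % 2) * (T + T⁻¹) ^ (n / 2)`. -/
def leadExp (n : ℕ) : ℤ := if n % 2 = 0 then -((n / 2 : ℕ) : ℤ) else (n / 2 : ℕ) + 1

/-- Division rounds down, so the `n`-th window contains exactly `n` exponents. The windows grow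
alternately to the right and left, and the leading exponents run through `0, 1, -1, 2, -2, …`. -/
theorem trace_pow_sub_T_leadExp (n : ℕ) :
    T ((n % 2 : ℕ) : ℤ) * trace F ^ (n / 2) - T (leadExp n) ∈
      window F (-(n : ℤ) / 2 + 1) (n / 2) := by
  rcases Nat.mod_two_eq_zero_or_one n with h | h
  · rw [leadExp, if_pos h, h, Nat.cast_zero, T_zero, one_mul]
    exact window_mono (by omega) (by omega) (trace_pow_sub_T_neg (n / 2))
  · rw [leadExp, if_neg (by omega), h, Nat.cast_one, add_comm ((n / 2 : ℕ) : ℤ) 1, T_add, ← mul_sub]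
    exact window_mono (by omega) (by omega) (T_mul_mem_window 1 (trace_pow_sub_T (n / 2)))

theorem trace_bijective :
    Function.Bijective (Finsupp.lsum F fun n : ℕ => LinearMap.toSpanSingleton F F[T;T⁻¹]
      (T ((n % 2 : ℕ) : ℤ) * trace F ^ (n / 2)) : (ℕ →₀ F) →ₗ[F] F[T;T⁻¹]) := by
  refine Finsupp.lsum_bijective_of_filtration
    (fun n : ℕ => window F (-(n : ℤ) / 2 + 1) (n / 2)) ?_ ?_ ?_ _ ?_ ?_ ?_
  · exact fun m n h => window_mono (by omega) (by omega)
  · rw [eq_bot_iff]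
    intro f hf
    rw [Submodule.mem_bot]
    ext d
    exact hf d (by simp; omega)
  · intro f
    -- If `S` bounds the absolute values of the exponents, window number `2S + 1` is `[-S, S]`.
    refine ⟨2 * f.coeff.support.sup Int.natAbs + 1, fun d hd => ?_⟩
    by_contra h
    have := Finset.le_sup (f := Int.natAbs) (Finsupp.mem_support_iff.mpr h)
    push_cast at hd
    omega
  · intro n x
    rw [LinearMap.toSpanSingleton_apply]
    refine Submodule.smul_mem _ _ ?_
    rw [← sub_add_cancel (T ((n % 2 : ℕ) : ℤ) * trace F ^ (n / 2)) (T (leadExp n))]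
    refine Submodule.add_mem _ (window_mono (by push_cast; omega) (by push_cast; omega)
      (trace_pow_sub_T_leadExp n)) (T_mem_window ?_ ?_) <;>
    · rw [leadExp]
      push_cast
      split_ifs <;> omega
  · intro n x hx
    rw [LinearMap.toSpanSingleton_apply,
      ← sub_add_cancel (T ((n % 2 : ℕ) : ℤ) * trace F ^ (n / 2)) (T (leadExp n)), smul_add,
      Submodule.add_mem_iff_right _ (Submodule.smul_mem _ _ (trace_pow_sub_T_leadExp n))] at hx
    have h := hx (leadExp n) (by rw [leadExp]; split_ifs <;> omega)
    rw [AddMonoidAlgebra.coeff_smul, Finsupp.smul_apply, T_apply, if_pos rfl] at h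
    simpa using h
  · intro n f hf
    refine ⟨f.coeff (leadExp n), ?_⟩
    have h : f - f.coeff (leadExp n) • T (leadExp n) ∈ window F (-(n : ℤ) / 2 + 1) (n / 2) := by
      intro d hd
      rw [AddMonoidAlgebra.coeff_sub, Finsupp.sub_apply, AddMonoidAlgebra.coeff_smul,
        Finsupp.smul_apply, T_apply]
      by_cases hde : leadExp n = d
      · subst hde; simp
      · rw [if_neg hde, smul_zero, sub_zero]
        refine hf d ?_
        rw [leadExp] at hde
        push_cast
        split_ifs at hde <;> omega
    have h' := Submodule.sub_mem _ h
      (Submodule.smul_mem _ (f.coeff (leadExp n)) (trace_pow_sub_T_leadExp (F := F) n))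
    rw [LinearMap.toSpanSingleton_apply]
    rw [smul_sub] at h'
    simpa using h'

variable (F) in
/-- The basis of Laurent polynomials formed by the products `(T + T⁻¹) ^ l * T ^ k`. -/
noncomputable def traceBasis : Module.Basis (ℕ × Fin 2) F F[T;T⁻¹] :=
  (Finsupp.basisSingleOne.map (LinearEquiv.ofBijective _ trace_bijective)).reindex
    (Nat.divModEquiv 2)

theorem traceBasis_apply (l : ℕ) (k : Fin 2) :
    traceBasis F (l, k) = T ((k : ℕ) : ℤ) * trace F ^ l := by
  have h1 : ((k : ℕ) : ℤ) % 2 = (k : ℕ) := by omega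
  have h2 : (l * 2 + (k : ℕ)) / 2 = l := by omega
  simp [traceBasis, Nat.divModEquiv, h1, h2]

end Window

end LaurentPolynomial

/-! ### Change of basis in one factor and assembly of the two families -/

/-- Replacing one basis of a tensor-like factor by another one. -/
theorem Module.Basis.exists_prod_of_factor {F ι κ κ' N H : Type*} [Field F] [AddCommGroup N]
    [Module F N] [AddCommGroup H] [Module F H] (b : Module.Basis (ι × κ) F H)
    (c : Module.Basis κ F N) (c' : Module.Basis κ' F N) (g : ι → N →ₗ[F] H)
    (hg : ∀ i k, g i (c k) = b (i, k)) :
    ∃ b' : Module.Basis (ι × κ') F H, ∀ i k, b' (i, k) = g i (c' k) := by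
  let e : (ι →₀ N) ≃ₗ[F] H := (Finsupp.basis fun _ : ι => c).equiv b (Equiv.sigmaEquivProd ι κ)
  have he (i : ι) : e.toLinearMap ∘ₗ Finsupp.lsingle i = g i := by
    refine c.ext fun k => ?_
    have h := (Finsupp.basis fun _ : ι => c).equiv_apply ⟨i, k⟩ b (Equiv.sigmaEquivProd ι κ)
    rw [Finsupp.coe_basis] at h
    exact h.trans (hg i k).symm
  refine ⟨((Finsupp.basis fun _ : ι => c').map e).reindex (Equiv.sigmaEquivProd ι κ'),
    fun i k => ?_⟩
  rw [← he]
  simp [Finsupp.coe_basis]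

namespace UDAHA

variable {F : Type*} [Field F] (q : F)

/-- The map from the polynomial ring sending the `i`-th variable to the central element `T i`. -/
noncomputable def centralMap : MvPolynomial (Fin 4) F →ₐ[F] UDAHA q :=
  (Subalgebra.center F (UDAHA q)).val.comp (MvPolynomial.aeval fun i =>
    (⟨T q i, Subalgebra.mem_center_iff.mpr fun b => (T_mul_comm i b).symm⟩ :
      Subalgebra.center F (UDAHA q)))

theorem centralMap_X (i : Fin 4) : centralMap q (MvPolynomial.X i) = T q i := by
  simp [centralMap]

theorem centralMap_mul_comm (p : MvPolynomial (Fin 4) F) (h : UDAHA q) :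
    centralMap q p * h = h * centralMap q p :=
  (Subalgebra.mem_center_iff.mp (Subtype.property _) h).symm

/-- Reordering of the PBW exponents. -/
noncomputable def monomialIndex : ((Fin 4 →₀ ℕ) × (ℤ × ℤ × Fin 2)) ≃ ℤ × ℤ × Fin 2 × ℕ × ℕ × ℕ × ℕ where
  toFun x := (x.2.1, x.2.2.1, x.2.2.2, x.1 0, x.1 1, x.1 2, x.1 3)
  invFun x := (Finsupp.equivFunOnFinite.symm ![x.2.2.2.1, x.2.2.2.2.1, x.2.2.2.2.2.1,
    x.2.2.2.2.2.2], x.1, x.2.1, x.2.2.1)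
  left_inv x := by
    refine Prod.ext (Finsupp.ext fun i => ?_) rfl
    fin_cases i <;> rfl
  right_inv x := rfl

theorem exists_basis_fin_two (hq : q ≠ 0) :
    ∃ b : Module.Basis (ℤ × ℤ × Fin 2 × ℕ × ℕ × ℕ × ℕ) F (UDAHA q),
      ∀ (i j : ℤ) (k : Fin 2) (l r s u : ℕ),
        b (i, j, k, l, r, s, u) =
          ((Y q ^ i : (UDAHA q)ˣ) : UDAHA q) * ((X q ^ j : (UDAHA q)ˣ) : UDAHA q) *
            (t q 0 : UDAHA q) ^ (k : ℕ) * T q 0 ^ l * T q 1 ^ r * T q 2 ^ s * T q 3 ^ u := by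
  -- Injectivity of `centralMap` is not needed: algebraic independence of the `T_i` comes out of the
  -- freeness over the polynomial ring.
  let _ : Algebra (MvPolynomial (Fin 4) F) (UDAHA q) :=
    (centralMap q).toRingHom.toAlgebra' (centralMap_mul_comm q)
  have halg (p : MvPolynomial (Fin 4) F) :
    algebraMap (MvPolynomial (Fin 4) F) (UDAHA q) p = centralMap q p := rfl
  have : IsScalarTower F (MvPolynomial (Fin 4) F) (UDAHA q) :=
    IsScalarTower.of_algebraMap_eq fun x => ((centralMap q).commutes x).symm
  obtain ⟨b, hb⟩ := exists_pbw_basis (q := q) (R := MvPolynomial (Fin 4) F)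
    (c := Units.map (algebraMap F (MvPolynomial (Fin 4) F) : F →* _) (Units.mk0 q hq))
    (a := MvPolynomial.X) rfl (fun i => centralMap_X q i) (MvPolynomial.adjoin_range_X)
  refine ⟨((MvPolynomial.basisMonomials (Fin 4) F).smulTower b).reindex monomialIndex,
    fun i j k l r s u => ?_⟩
  rw [Module.Basis.reindex_apply, Module.Basis.smulTower_apply]
  change MvPolynomial.basisMonomials (Fin 4) F (Finsupp.equivFunOnFinite.symm ![l, r, s, u]) •
    b (i, j, k) = _
  rw [hb, Algebra.smul_def, Algebra.commutes, halg, MvPolynomial.coe_basisMonomials]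
  beta_reduce
  rw [MvPolynomial.monomial_eq, Finsupp.prod_fintype _ _ (by simp), Fin.prod_univ_four]
  simp [centralMap_X, mul_assoc]

/-- Reordering of the PBW exponents isolating those of `t₀` and `T₀`. -/
def splitIndex : (ℤ × ℤ × Fin 2 × ℕ × ℕ × ℕ × ℕ) ≃ (ℤ × ℤ × ℕ × ℕ × ℕ) × (ℕ × Fin 2) where
  toFun x := ((x.1, x.2.1, x.2.2.2.2.1, x.2.2.2.2.2.1, x.2.2.2.2.2.2), x.2.2.2.1, x.2.2.1)
  invFun y := (y.1.1, y.1.2.1, y.2.2, y.2.1, y.1.2.2.1, y.1.2.2.2.1, y.1.2.2.2.2)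
  left_inv _ := rfl
  right_inv _ := rfl

/-- Reordering of the PBW exponents isolating that of `t₀`. -/
def mergeIndex : (ℤ × ℤ × ℕ × ℕ × ℕ) × ℤ ≃ (ℤ × ℤ × ℤ × ℕ × ℕ × ℕ) where
  toFun y := (y.1.1, y.1.2.1, y.2, y.1.2.2.1, y.1.2.2.2.1, y.1.2.2.2.2)
  invFun x := ((x.1, x.2.1, x.2.2.2.1, x.2.2.2.2.1, x.2.2.2.2.2), x.2.2.1)
  left_inv _ := rfl
  right_inv _ := rfl

open LaurentPolynomial in
-- With the other exponents fixed, `g` embeds `F[T;T⁻¹]` by `T ↦ t₀` and `T + T⁻¹ ↦ T₀`. It carries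
-- `traceBasis` to members of family (i) and the monomial basis to members of family (ii).
theorem exists_basis_int (hq : q ≠ 0) :
    ∃ b : Module.Basis (ℤ × ℤ × ℤ × ℕ × ℕ × ℕ) F (UDAHA q),
      ∀ (i j k : ℤ) (r s u : ℕ),
        b (i, j, k, r, s, u) =
          ((Y q ^ i : (UDAHA q)ˣ) : UDAHA q) * ((X q ^ j : (UDAHA q)ˣ) : UDAHA q) *
            ((t q 0 ^ k : (UDAHA q)ˣ) : UDAHA q) * UDAHA.T q 1 ^ r * UDAHA.T q 2 ^ s *
            UDAHA.T q 3 ^ u := by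
  obtain ⟨b, hb⟩ := exists_basis_fin_two q hq
  let g (x : ℤ × ℤ × ℕ × ℕ × ℕ) : F[T;T⁻¹] →ₗ[F] UDAHA q :=
    LinearMap.mulRight F (UDAHA.T q 1 ^ x.2.2.1 * UDAHA.T q 2 ^ x.2.2.2.1 *
      UDAHA.T q 3 ^ x.2.2.2.2) ∘ₗ
    LinearMap.mulLeft F (((Y q ^ x.1 : (UDAHA q)ˣ) : UDAHA q) *
      ((X q ^ x.2.1 : (UDAHA q)ˣ) : UDAHA q)) ∘ₗ (evalUnit (t q 0)).toLinearMap
  have htr : evalUnit (t q 0) (trace F) = UDAHA.T q 0 := by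
    simp [trace, UDAHA.T]
  obtain ⟨b', hb'⟩ := (b.reindex splitIndex).exists_prod_of_factor (traceBasis F)
    (AddMonoidAlgebra.basis ℤ F) g (by
      rintro ⟨i, j, r, s, u⟩ ⟨l, k⟩
      rw [Module.Basis.reindex_apply]
      change _ = b (i, j, k, l, r, s, u)
      rw [hb, traceBasis_apply]
      simp only [g, LinearMap.comp_apply, AlgHom.toLinearMap_apply, map_mul, map_pow, htr,
        evalUnit_T, LinearMap.mulLeft_apply, LinearMap.mulRight_apply, mul_assoc, zpow_natCast,
        Units.val_pow_eq_pow_val])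
  refine ⟨b'.reindex mergeIndex, fun i j k r s u => ?_⟩
  rw [Module.Basis.reindex_apply]
  change b' ((i, j, r, s, u), k) = _
  rw [hb']
  have hT : AddMonoidAlgebra.basis ℤ F k = LaurentPolynomial.T k := by
    simp [LaurentPolynomial.T, -single_eq_C_mul_T]
  rw [hT]
  simp only [g, LinearMap.comp_apply, AlgHom.toLinearMap_apply,
    evalUnit_T, LinearMap.mulLeft_apply, LinearMap.mulRight_apply, mul_assoc]

end UDAHA

theorem proposition7 {F : Type*} [Field F] (q : F) (hq : q ≠ 0) (hq4 : q ^ 4 ≠ 1) :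
    (∃ b : Module.Basis (ℤ × ℤ × Fin 2 × ℕ × ℕ × ℕ × ℕ) F (UDAHA q),
      ∀ (i j : ℤ) (k : Fin 2) (l r s u : ℕ),
        b (i, j, k, l, r, s, u) =
          ((UDAHA.Y q ^ i : (UDAHA q)ˣ) : UDAHA q) * ((UDAHA.X q ^ j : (UDAHA q)ˣ) : UDAHA q) *
            (UDAHA.t q 0 : UDAHA q) ^ (k : ℕ) *
            UDAHA.T q 0 ^ l * UDAHA.T q 1 ^ r * UDAHA.T q 2 ^ s * UDAHA.T q 3 ^ u) ∧
    (∃ b : Module.Basis (ℤ × ℤ × ℤ × ℕ × ℕ × ℕ) F (UDAHA q),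
      ∀ (i j k : ℤ) (r s u : ℕ),
        b (i, j, k, r, s, u) =
          ((UDAHA.Y q ^ i : (UDAHA q)ˣ) : UDAHA q) * ((UDAHA.X q ^ j : (UDAHA q)ˣ) : UDAHA q) *
            ((UDAHA.t q 0 ^ k : (UDAHA q)ˣ) : UDAHA q) *
            UDAHA.T q 1 ^ r * UDAHA.T q 2 ^ s * UDAHA.T q 3 ^ u) :=
  ⟨UDAHA.exists_basis_fin_two q hq, UDAHA.exists_basis_int q hq⟩
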